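/- Call a sequence $(n_k)_{k\ge 0}$ of integers a \emph{TB-sequence} if there is a group topology $\tau$ on $\mathbb Z$ that is precompact and satisfies $n_k\to 0$ for $\tau$ as $k\to\infty$. Here $\tau$ is precompact if it is Hausdorff and, for every non-empty $\tau$-open set $U\subseteq\mathbb Z$, there is a finite set $F\subseteq\mathbb Z$ with $U+F=\mathbb Z$. Call a sequence $(n_k)_{k\ge 0}$ of integers a \emph{rigidity sequence} if there are a probability space $(X,\mathcal B,m)$, non-trivial in the sense that $0<m(A)<1$ for some $A\in\mathcal B$, and an invertible bimeasurable $m$-preserving transformation $T$ of $X$ such that $T$ is weakly mixing and $m(T^{-n_k}A\,\Delta\,A)\to 0$ as $k\to\infty$ for every $A\in\mathcal B$. Here $T$ is weakly mixing if for every complex $f\in L^2(X,\mathcal B,m)$ with $\int_X f\,dm=0$, the spectral measure of $f$, i.e. the finite Borel measure $\sigma_f$ on the unit circle $\mathbb T=\{z\in\mathbb C:|z|=1\}$ with $\int_{\mathbb T}z^n\,d\sigma_f(z)=\int_X (f\circ T^n)\,\overline{f}\,dm$ for all $n\in\mathbb Z$, has no atoms. Then every TB-sequence is a rigidity sequence.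 The converse fails: there is a rigidity sequence of positive integers that is not a TB-sequence. -/

import Mathlib

open Filter MeasureTheory Topology
open scoped Pointwise ComplexConjugate

/-- A sequence of integers is a *TB-sequence* (totally bounded sequence) if it tends to `0` for
some precompact group topology on `ℤ`, where a Hausdorff group topology is precompact if finitely
many translates of any nonempty open set cover the group. -/
def IsTBSequence (n : ℕ → ℤ) : Prop :=
  ∃ τ : TopologicalSpace ℤ,
    @IsTopologicalAddGroup ℤ τ _ ∧ @T2Space ℤ τ ∧
    (∀ U : Set ℤ, IsOpen[τ] U → U.Nonempty → ∃ F : Set ℤ, F.Finite ∧ U + F = Set.univ) ∧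
    Tendsto n atTop (@nhds ℤ τ 0)

/-- The `n`-th iterate, `n ∈ ℤ`, of an invertible bimeasurable transformation. -/
def iter {X : Type*} [MeasurableSpace X] (T : X ≃ᵐ X) (n : ℤ) : X → X :=
  ⇑((T.toEquiv : Equiv.Perm X) ^ n)

/-- The unit circle carries its Borel `σ`-algebra. -/
noncomputable instance circleMeasurableSpace : MeasurableSpace Circle := borel Circle

instance circleBorelSpace : BorelSpace Circle := ⟨rfl⟩

/-- `σ` is the spectral measure of `f` with respect to the Koopman operator `U f = f ∘ T` on
`L²(m)`: it is the finite Borel measure on the unit circle whose `n`-th Fourier coefficient is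
`⟨Uⁿ f, f⟩` for every `n ∈ ℤ`. (By Herglotz's theorem every `f ∈ L²(m)` has exactly one.) -/
def IsSpectralMeasure {X : Type*} [MeasurableSpace X] (m : Measure X) (T : X ≃ᵐ X)
    (f : X → ℂ) (σ : Measure Circle) : Prop :=
  IsFiniteMeasure σ ∧
    ∀ n : ℤ, ∫ z : Circle, (z : ℂ) ^ n ∂σ = ∫ x, f (iter T n x) * conj (f x) ∂m

/-- Weak mixing: the spectral measure of the Koopman operator on
`L²₀(m) = {f ∈ L²(m) : ∫ f dm = 0}` is continuous, that is, the spectral measure of every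
`f ∈ L²₀(m)` has no atoms. -/
def IsWeaklyMixing {X : Type*} [MeasurableSpace X] (m : Measure X) (T : X ≃ᵐ X) : Prop :=
  ∀ f : X → ℂ, MemLp f 2 m → ∫ x, f x ∂m = 0 →
    ∀ σ : Measure Circle, IsSpectralMeasure m T f σ → ∀ z : Circle, σ {z} = 0

/-- The sequence `n` is rigid for the system `(X, m, T)`: `m (T^{-n_k} A ∆ A) → 0` for every
measurable set `A`. -/
def IsRigidFor {X : Type*} [MeasurableSpace X] (m : Measure X) (T : X ≃ᵐ X)
    (n : ℕ → ℤ) : Prop :=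
  ∀ A : Set X, MeasurableSet A →
    Tendsto (fun k => m (symmDiff (iter T (n k) ⁻¹' A) A)) atTop (𝓝 0)

/-- A *rigidity sequence* is a sequence of integers that is rigid for some weakly mixing
(invertible) measure-preserving system on a nontrivial probability space. Nontrivial means that
some event has probability strictly between `0` and `1`; on a trivial space weak mixing and
rigidity would hold for an empty reason. -/
def IsRigiditySequence (n : ℕ → ℤ) : Prop :=
  ∃ (X : Type) (_ : MeasurableSpace X) (m : Measure X) (T : X ≃ᵐ X),
    IsProbabilityMeasure m ∧ (∃ A : Set X, MeasurableSet A ∧ 0 < m A ∧ m A < 1) ∧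
    MeasurePreserving T m m ∧ IsWeaklyMixing m T ∧ IsRigidFor m T n

/-!
Both halves of the theorem are governed by the group `limitGroup n` of all points `z` of the circle
with `z ^ n k → 1`.

**Gaussian systems.** A positive definite `φ : ℤ → ℝ` with `φ 0 = 1` is the autocovariance of a
stationary Gaussian process, whose law is a shift-invariant measure on `ℤ → ℝ`
(`exists_gaussianMeasure`, `measurePreserving_shift`). The characters `expChar c` span a dense
subspace of `L²` and their correlations are explicit in `φ`. Hence the shift is weakly mixing if `φ`
is small on average (`IsCesaroNull`), because a measure on the circle with such Fourier coefficients
has no atoms; and `n` is rigid for the shift if `φ (n k + t) → φ t` for every `t`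
(`isRigiditySequence_of_posSemidef`).

**Trees.** Such a `φ` is the real part of the Fourier transform of a continuous measure on the circle,
the limit of the uniform measures on the first `2 ^ m` points of a sequence `w` in which
`w (i + 2 ^ m)` is extremely close to `w i`. If for large `k` all but one of the first points
satisfy `w i ^ n k ≈ 1`, and the later points are too close to their parents to be separated by
`n k`, then `n` is a rigidity sequence (`IsTree.isRigiditySequence`). The exceptional point is
harmless, since its descendants have small mass.

**Totally bounded sequences.** If `limitGroup n` is infinite, the tree can be chosen inside it, without
exceptional points (`isRigiditySequence_of_infinite_limitGroup`). For a TB-sequence `limitGroup n` is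
infinite: the completion of `ℤ` is a compact group, and for `d ≠ 0` there is a character of `ℤ`,
continuous for the given topology and nontrivial at `d` (`exists_pow_ne_one_and_eventually`). It is
obtained without the Peter–Weyl theorem. Let `h` be a continuous function on the compact group that
separates `d` from `0`, and let `g` be the difference of its translate by `d` and itself. The
autocorrelation of `g` along `ℤ` recurs with positive frequency, so its Fejér sums have maximal order
at some `z` (`exists_fejerSum_ge`). At such a `z` the orbit sums of `g` have norm proportional to
their length on average; this makes `m ↦ z ^ m` continuous, because `g` is uniformly continuous, and
forces `z ^ d ≠ 1`, because for `z ^ d = 1` the orbit sums telescope.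

**The converse.** Let the points `w i` of a tree have distinct prime orders. Among the exponents `r`
for which all but one of `w 0 ^ r, …, w j ^ r` equal `1` are the positive multiples of the product of all
but one of the orders. A point `z` with `‖z ^ r - 1‖ ≤ 1` for all those `r` is `1`: no power of `z` to
such a product can have all its powers near `1` without being `1`, and these products are coprime. By
compactness finitely many exponents `r` force `‖z - 1‖ < 1 / (j + 1)` (`exists_finset_exponents`). The
sequence `n` enumerates these finite sets for all `j`. It is a rigidity sequence by the criterion for
trees, but `limitGroup n` is trivial (`exists_isRigiditySequence_limitGroup_eq_bot`), so `n` is not a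
TB-sequence.
-/

/-! ### Gaussian measures on countable products -/

section GaussianMeasure

open ProbabilityTheory

variable {ι : Type*}

/-- The linear functional `x ↦ ∑ c i * x i` on `ι → ℝ` with finitely supported coefficients `c`. -/
noncomputable def pairing (c : ι →₀ ℝ) (x : ι → ℝ) : ℝ := Finsupp.linearCombination ℝ x c

/-- The bilinear form on finitely supported functions with matrix `K`. -/
noncomputable def covForm (K : Matrix ι ι ℝ) (c d : ι →₀ ℝ) : ℝ :=
  c.sum fun a s => d.sum fun b t => s * K a b * t

theorem pairing_eq_sum (c : ι →₀ ℝ) {I : Finset ι} (hI : c.support ⊆ I) (x : ι → ℝ) :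
    pairing c x = ∑ i ∈ I, c i * x i := by
  rw [pairing, Finsupp.linearCombination_apply, Finsupp.sum_of_support_subset _ hI] <;> simp

theorem covForm_eq_sum (K : Matrix ι ι ℝ) (c d : ι →₀ ℝ) {I J : Finset ι} (hI : c.support ⊆ I)
    (hJ : d.support ⊆ J) : covForm K c d = ∑ i ∈ I, ∑ j ∈ J, c i * K i j * d j := by
  rw [covForm, Finsupp.sum_of_support_subset _ hI]
  · refine Finset.sum_congr rfl fun i _ => ?_
    rw [Finsupp.sum_of_support_subset _ hJ]; simp
  · simp

theorem continuous_pairing (c : ι →₀ ℝ) : Continuous (pairing c) := by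
  have : pairing c = fun x => ∑ i ∈ c.support, c i * x i :=
    funext fun x => pairing_eq_sum c subset_rfl x
  rw [this]; fun_prop

theorem pairing_add (c d : ι →₀ ℝ) (x : ι → ℝ) :
    pairing (c + d) x = pairing c x + pairing d x := by simp [pairing]

theorem pairing_neg (c : ι →₀ ℝ) (x : ι → ℝ) : pairing (-c) x = -pairing c x := by simp [pairing]

/-- The character `x ↦ exp (i ∑ c j * x j)` of `ι → ℝ`. -/
noncomputable def expChar (c : ι →₀ ℝ) (x : ι → ℝ) : ℂ := Complex.exp (pairing c x * Complex.I)

theorem continuous_expChar (c : ι →₀ ℝ) : Continuous (expChar c) := by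
  have := continuous_pairing c
  unfold expChar; fun_prop

theorem norm_expChar (c : ι →₀ ℝ) (x : ι → ℝ) : ‖expChar c x‖ = 1 := by
  simp [expChar, Complex.norm_exp]

theorem expChar_add (c d : ι →₀ ℝ) (x : ι → ℝ) :
    expChar (c + d) x = expChar c x * expChar d x := by
  simp [expChar, pairing_add, add_mul, Complex.exp_add]

theorem conj_expChar (c : ι →₀ ℝ) (x : ι → ℝ) : conj (expChar c x) = expChar (-c) x := by
  simp [expChar, pairing_neg, ← Complex.exp_conj]

open Classical in
/-- Extension of a finitely indexed vector by zero. -/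
noncomputable def extendZero (I : Finset ι) (v : EuclideanSpace ℝ I) (i : ι) : ℝ :=
  if h : i ∈ I then v ⟨i, h⟩ else 0

theorem continuous_extendZero (I : Finset ι) : Continuous (extendZero I) := by
  refine continuous_pi fun i => ?_
  unfold extendZero
  split_ifs <;> fun_prop

open Classical in
/-- The centred Gaussian measure with covariance `K` on the coordinates in `I`, the other
coordinates being `0`. -/
noncomputable def gaussianTrunc (K : Matrix ι ι ℝ) (I : Finset ι) : Measure (ι → ℝ) :=
  (multivariateGaussian 0 (K.submatrix (Subtype.val : I → ι) Subtype.val)).map (extendZero I)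

instance [Countable ι] (K : Matrix ι ι ℝ) (I : Finset ι) : IsProbabilityMeasure (gaussianTrunc K I) :=
  Measure.isProbabilityMeasure_map (continuous_extendZero I).measurable.aemeasurable

theorem integral_expChar_gaussianTrunc [Countable ι] {K : Matrix ι ι ℝ} (hK : K.PosSemidef) {I : Finset ι}
    {c : ι →₀ ℝ} (hc : c.support ⊆ I) :
    ∫ x, expChar c x ∂gaussianTrunc K I = Complex.exp (-(covForm K c c) / 2) := by
  classical
  rw [gaussianTrunc, integral_map (continuous_extendZero I).measurable.aemeasurable]
  · have h1 : ∀ v : EuclideanSpace ℝ I, expChar c (extendZero I v) =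
        Complex.exp (inner ℝ v (WithLp.toLp 2 fun i : I => c i) * Complex.I) := by
      intro v
      rw [expChar, pairing_eq_sum c hc, ← Finset.sum_coe_sort I]
      congr 3
      rw [PiLp.inner_apply]
      refine Finset.sum_congr rfl fun i _ => ?_
      simp [extendZero, mul_comm]
    simp_rw [h1]
    rw [← charFun_apply, charFun_multivariateGaussian (hK.submatrix _)]
    congr 1
    rw [covForm_eq_sum K c c hc hc]
    simp only [inner_zero_right, Complex.ofReal_zero, zero_mul, zero_sub, dotProduct,
      Matrix.mulVec, Matrix.submatrix_apply]
    rw [← Finset.sum_coe_sort I]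
    rw [neg_div]
    congr 3
    refine Finset.sum_congr rfl fun i _ => ?_
    rw [Finset.mul_sum, ← Finset.sum_coe_sort I]
    exact Finset.sum_congr rfl fun j _ => by ring
  · exact (continuous_expChar c).aestronglyMeasurable

theorem gaussianTrunc_map_eval [Countable ι] {K : Matrix ι ι ℝ} (hK : K.PosSemidef) (I : Finset ι) (i : ι) :
    (gaussianTrunc K I).map (fun x => x i) = gaussianReal 0 (K i i).toNNReal ∨
    (gaussianTrunc K I).map (fun x => x i) = Measure.dirac 0 := by
  classical
  rw [gaussianTrunc, Measure.map_map (measurable_pi_apply i) (continuous_extendZero I).measurable]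
  by_cases h : i ∈ I
  · left
    have h1 := (measurePreserving_eval_multivariateGaussian (μ := 0)
      (hK.submatrix (Subtype.val : I → ι)) (i := ⟨i, h⟩)).map_eq
    simp only [PiLp.zero_apply, Matrix.submatrix_apply] at h1
    rw [← h1]
    congr 1
    funext v
    simp [extendZero, h]
  · right
    have : (fun x : ι → ℝ => x i) ∘ extendZero I = fun _ => 0 := by
      funext v; simp [extendZero, h]
    rw [this, Measure.map_const]; simp

/-- The truncated Gaussian measures are tight, since each coordinate has only two possible laws. -/
theorem isTightMeasureSet_gaussianTrunc [Countable ι] {K : Matrix ι ι ℝ} (hK : K.PosSemidef) :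
    IsTightMeasureSet (Set.range (gaussianTrunc K)) := by
  rw [isTightMeasureSet_iff_exists_isCompact_measure_compl_le]
  intro ε hε
  obtain ⟨δ, hδ, hsum⟩ := ENNReal.exists_pos_sum_of_countable hε.ne' ι
  have h1 : ∀ i, ∃ C : Set ℝ, IsCompact C ∧
      ∀ μ ∈ ({gaussianReal 0 (K i i).toNNReal} ∪ {Measure.dirac 0} : Set (Measure ℝ)),
        μ Cᶜ ≤ δ i := fun i =>
    isTightMeasureSet_iff_exists_isCompact_measure_compl_le.1
      (isTightMeasureSet_singleton.union isTightMeasureSet_singleton) (δ i) (by simpa using hδ i)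
  choose C hC hCle using h1
  refine ⟨Set.pi Set.univ C, isCompact_univ_pi hC, ?_⟩
  rintro _ ⟨I, rfl⟩
  have h2 : (Set.pi Set.univ C)ᶜ ⊆ ⋃ i, (fun x : ι → ℝ => x i) ⁻¹' (C i)ᶜ := by
    intro x hx
    simpa [Set.mem_pi] using hx
  refine (measure_mono h2).trans ((measure_iUnion_le _).trans ((ENNReal.tsum_le_tsum fun i => ?_).trans
    hsum.le))
  rw [← Measure.map_apply (measurable_pi_apply i) (hC i).measurableSet.compl]
  exact hCle i _ ((gaussianTrunc_map_eval hK I i).imp id id)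

/-- A positive semidefinite matrix over a countable index set is the covariance matrix of a centred
Gaussian measure, obtained as a limit point of the truncated measures by Prokhorov's theorem. -/
theorem exists_gaussianMeasure [Countable ι] {K : Matrix ι ι ℝ} (hK : K.PosSemidef) :
    ∃ P : Measure (ι → ℝ), IsProbabilityMeasure P ∧
      ∀ c : ι →₀ ℝ, ∫ x, expChar c x ∂P = Complex.exp (-(covForm K c c) / 2) := by
  classical
  let M : Finset ι → ProbabilityMeasure (ι → ℝ) := fun I => ⟨gaussianTrunc K I, inferInstance⟩
  have hcomp : IsCompact (closure (Set.range M)) := by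
    refine isCompact_closure_of_isTightMeasureSet ((isTightMeasureSet_gaussianTrunc hK).subset ?_)
    rintro _ ⟨_, ⟨I, rfl⟩, rfl⟩
    exact ⟨I, rfl⟩
  let F : Ultrafilter (Finset ι) := Ultrafilter.of atTop
  obtain ⟨P, -, hP⟩ := hcomp.ultrafilter_le_nhds' (F.map M)
    (Ultrafilter.mem_map.2 (Filter.mem_of_superset Filter.univ_mem
      (fun I _ => subset_closure (Set.mem_range_self I))))
  refine ⟨P, inferInstance, fun c => ?_⟩
  let g : BoundedContinuousFunction (ι → ℝ) ℂ :=
    BoundedContinuousFunction.ofNormedAddCommGroup (expChar c) (continuous_expChar c) 1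
      fun x => (norm_expChar c x).le
  have h1 := (ProbabilityMeasure.tendsto_iff_forall_integral_rclike_tendsto ℂ
    (μs := M) (F := (F : Filter (Finset ι))) (μ := P)).1 hP g
  refine tendsto_nhds_unique h1 (tendsto_const_nhds.congr' ?_)
  have h2 : ∀ᶠ I in (F : Filter (Finset ι)), c.support ⊆ I :=
    (Ultrafilter.of_le atTop) (eventually_ge_atTop c.support)
  filter_upwards [h2] with I hI
  exact (integral_expChar_gaussianTrunc hK hI).symm

open scoped PiCountable in
/-- A finite measure on `ι → ℝ` is determined by its characteristic functional. -/
theorem measure_ext_of_expChar [Countable ι] {P P' : Measure (ι → ℝ)} [IsFiniteMeasure P]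
    [IsFiniteMeasure P'] (h : ∀ c : ι →₀ ℝ, ∫ x, expChar c x ∂P = ∫ x, expChar c x ∂P') :
    P = P' := by
  have := Encodable.ofCountable ι
  let : TopologicalSpace (ι →₀ ℝ) := ⊥
  have : DiscreteTopology (ι →₀ ℝ) := ⟨rfl⟩
  let L : (ι → ℝ) →ₗ[ℝ] (ι →₀ ℝ) →ₗ[ℝ] ℝ := LinearMap.mk₂ ℝ (fun x c => pairing c x)
    (fun x y c => by simp [pairing, Finsupp.linearCombination_apply, mul_add, Finsupp.sum_add])
    (fun a x c => by
      simp [pairing, Finsupp.linearCombination_apply, Finsupp.mul_sum, mul_left_comm])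
    (fun x c d => pairing_add c d x) (fun a x c => by simp [pairing])
  refine ext_of_integral_char_eq (V := ι → ℝ) (W := ι →₀ ℝ) (L := L) Real.continuous_probChar
    Real.probChar_ne_one ?_ ?_ h
  · intro v hv hv'
    obtain ⟨i, hi⟩ := Function.ne_iff.1 hv
    have := LinearMap.congr_fun hv' (Finsupp.single i 1)
    simp [L, pairing] at this
    exact hi this
  · exact continuous_prod_of_discrete_right.2 fun c => continuous_pairing c

end GaussianMeasure

/-! ### Decorrelation on average and atoms -/

section CesaroNull

variable {E : Type*} [SeminormedAddCommGroup E]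

/-- The Fejér mean of `‖ψ‖` over the differences of pairs of points of `{0, …, N - 1}`. -/
noncomputable def fejerMean (ψ : ℤ → E) (N : ℕ) : ℝ :=
  (∑ a ∈ Finset.range N, ∑ b ∈ Finset.range N, ‖ψ (a - b)‖) / (N : ℝ) ^ 2

/-- A function on `ℤ` is Cesàro null if its Fejér means tend to `0`. -/
def IsCesaroNull (ψ : ℤ → E) : Prop := Tendsto (fejerMean ψ) atTop (𝓝 0)

theorem fejerMean_nonneg (ψ : ℤ → E) (N : ℕ) : 0 ≤ fejerMean ψ N := by
  unfold fejerMean; positivity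

theorem fejerMean_le_of_norm_le {ψ : ℤ → E} {C : ℝ} (hC : ∀ n, ‖ψ n‖ ≤ C) (N : ℕ) :
    fejerMean ψ N ≤ C := by
  have hC0 : 0 ≤ C := (norm_nonneg _).trans (hC 0)
  unfold fejerMean
  rcases N.eq_zero_or_pos with rfl | hN
  · simpa using hC0
  rw [div_le_iff₀ (by positivity)]
  calc _ ≤ ∑ a ∈ Finset.range N, ∑ b ∈ Finset.range N, C :=
        Finset.sum_le_sum fun a _ => Finset.sum_le_sum fun b _ => hC _
    _ = C * (N : ℝ) ^ 2 := by simp; ring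

theorem fejerMean_mono {E' : Type*} [SeminormedAddCommGroup E'] {ψ : ℤ → E} {χ : ℤ → E'}
    (h : ∀ n, ‖ψ n‖ ≤ ‖χ n‖) (N : ℕ) : fejerMean ψ N ≤ fejerMean χ N := by
  unfold fejerMean
  gcongr
  exact h _

theorem fejerMean_add_le (ψ χ : ℤ → E) (N : ℕ) :
    fejerMean (fun n => ψ n + χ n) N ≤ fejerMean ψ N + fejerMean χ N := by
  unfold fejerMean
  rw [← add_div, ← Finset.sum_add_distrib]
  gcongr
  rw [← Finset.sum_add_distrib]
  gcongr
  exact norm_add_le _ _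

theorem IsCesaroNull.mono {E' : Type*} [SeminormedAddCommGroup E'] {ψ : ℤ → E} {χ : ℤ → E'}
    (hχ : IsCesaroNull χ) (h : ∀ n, ‖ψ n‖ ≤ ‖χ n‖) : IsCesaroNull ψ :=
  squeeze_zero (fejerMean_nonneg ψ) (fejerMean_mono h) hχ

theorem IsCesaroNull.add {ψ χ : ℤ → E} (hψ : IsCesaroNull ψ) (hχ : IsCesaroNull χ) :
    IsCesaroNull fun n => ψ n + χ n :=
  squeeze_zero (fejerMean_nonneg _) (fejerMean_add_le ψ χ) (by simpa using Tendsto.add hψ hχ)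

theorem isCesaroNull_zero : IsCesaroNull fun _ : ℤ => (0 : E) := by
  have : fejerMean (fun _ : ℤ => (0 : E)) = fun _ => 0 := by funext N; simp [fejerMean]
  rw [IsCesaroNull, this]
  exact tendsto_const_nhds

theorem IsCesaroNull.sum {ι : Type*} (s : Finset ι) {ψ : ι → ℤ → E}
    (h : ∀ i ∈ s, IsCesaroNull (ψ i)) : IsCesaroNull fun n => ∑ i ∈ s, ψ i n := by
  classical
  induction s using Finset.induction_on with
  | empty => simpa using isCesaroNull_zero
  | insert i s his ih =>
    simp only [Finset.sum_insert his]
    exact (h i (by simp)).add (ih fun j hj => h j (by simp [hj]))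

theorem IsCesaroNull.const_mul {ψ : ℤ → ℝ} (hψ : IsCesaroNull ψ) (C : ℝ) :
    IsCesaroNull fun n => C * ψ n := by
  have : fejerMean (fun n => C * ψ n) = fun N => |C| * fejerMean ψ N := by
    funext N
    simp only [fejerMean, norm_mul, Real.norm_eq_abs, ← Finset.mul_sum, mul_div_assoc]
  rw [IsCesaroNull, this]
  simpa using Tendsto.const_mul |C| hψ

theorem isCesaroNull_of_approx {ψ : ℤ → E}
    (h : ∀ ε > 0, ∃ χ : ℤ → E, IsCesaroNull χ ∧ ∀ n, ‖ψ n - χ n‖ ≤ ε) : IsCesaroNull ψ := by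
  refine tendsto_order.2 ⟨fun a ha => .of_forall fun N => ha.trans_le (fejerMean_nonneg ψ N),
    fun ε hε => ?_⟩
  obtain ⟨χ, hχ, hψχ⟩ := h (ε / 2) (by positivity)
  filter_upwards [(tendsto_order.1 hχ).2 (ε / 2) (by positivity)] with N hN
  have h1 := fejerMean_add_le (fun n => ψ n - χ n) χ N
  simp only [sub_add_cancel] at h1
  have h2 := fejerMean_le_of_norm_le hψχ N
  linarith

/-- A bounded Cesàro null function remains so after a translation. -/
theorem IsCesaroNull.comp_add {ψ : ℤ → E} (hψ : IsCesaroNull ψ) {C : ℝ} (hC : ∀ n, ‖ψ n‖ ≤ C)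
    (t : ℤ) : IsCesaroNull fun n => ψ (n + t) := by
  -- It suffices to translate by `1` and by `-1`; either changes a Fejér mean by at most `C / N`.
  have hC0 : 0 ≤ C := (norm_nonneg _).trans (hC 0)
  have hlim : ∀ χ : ℤ → E, IsCesaroNull χ →
      Tendsto (fun N : ℕ => fejerMean χ N + C / N) atTop (𝓝 0) := fun χ hχ => by
    simpa using Tendsto.add hχ (tendsto_const_div_atTop_nhds_zero_nat C)
  have key : ∀ χ : ℤ → E, (∀ n, ‖χ n‖ ≤ C) → ∀ N : ℕ, ∀ b : ℤ,
      ∑ a ∈ Finset.range N, ‖χ (a - b + 1)‖ ≤ ∑ a ∈ Finset.range N, ‖χ (a - b)‖ + C := by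
    intro χ hχ N b
    have h1 := Finset.sum_range_succ (fun a : ℕ => ‖χ (a - b)‖) N
    have h2 := Finset.sum_range_succ' (fun a : ℕ => ‖χ (a - b)‖) N
    have h3 : ∀ a : ℕ, ‖χ (a - b + 1)‖ = ‖χ ((a + 1 : ℕ) - b)‖ := fun a => by
      congr 2; push_cast; ring
    simp_rw [h3]
    linarith [hχ (N - b), norm_nonneg (χ ((0 : ℕ) - b))]
  have bound : ∀ χ χ' : ℤ → E, (∀ N : ℕ, ∀ b : ℕ, ∑ a ∈ Finset.range N, ‖χ' (a - b)‖ ≤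
      ∑ a ∈ Finset.range N, ‖χ (a - b)‖ + C) → IsCesaroNull χ → IsCesaroNull χ' := by
    intro χ χ' h hχ
    refine squeeze_zero (fejerMean_nonneg _) (fun N => ?_) (hlim χ hχ)
    unfold fejerMean
    rcases N.eq_zero_or_pos with rfl | hN
    · simp
    have : C / N = N * C / (N : ℝ) ^ 2 := by field_simp
    rw [this, ← add_div]
    gcongr
    calc ∑ a ∈ Finset.range N, ∑ b ∈ Finset.range N, ‖χ' (a - b)‖
        = ∑ b ∈ Finset.range N, ∑ a ∈ Finset.range N, ‖χ' (a - b)‖ := Finset.sum_comm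
      _ ≤ ∑ b ∈ Finset.range N, (∑ a ∈ Finset.range N, ‖χ (a - b)‖ + C) :=
          Finset.sum_le_sum fun b _ => h N b
      _ = ∑ a ∈ Finset.range N, ∑ b ∈ Finset.range N, ‖χ (a - b)‖ + N * C := by
          rw [Finset.sum_add_distrib, Finset.sum_comm]; simp
  have hneg : ∀ χ : ℤ → E, IsCesaroNull χ → IsCesaroNull fun n => χ (-n) := by
    intro χ hχ
    refine Tendsto.congr (fun N => ?_) hχ
    unfold fejerMean
    rw [Finset.sum_comm]
    simp
  have hsucc : ∀ χ : ℤ → E, (∀ n, ‖χ n‖ ≤ C) → IsCesaroNull χ → IsCesaroNull fun n => χ (n + 1) :=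
    fun χ hb hχ => bound χ _ (fun N b => key χ hb N b) hχ
  have hpred : ∀ χ : ℤ → E, (∀ n, ‖χ n‖ ≤ C) → IsCesaroNull χ →
      IsCesaroNull fun n => χ (n - 1) := by
    intro χ hb hχ
    have := hneg _ (hsucc _ (fun n => hb (-n)) (hneg χ hχ))
    refine this.congr' (.of_forall fun N => ?_)
    have : ∀ n : ℤ, -(-n + 1) = n - 1 := fun n => by ring
    simp only [this]
  induction t using Int.induction_on with
  | zero => simpa using hψ
  | succ i ih =>
    have := hsucc _ (fun n => hC _) ih
    simpa only [add_assoc, add_comm (1 : ℤ)] using this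
  | pred i ih =>
    have := hpred _ (fun n => hC _) ih
    simpa only [sub_eq_add_neg, add_assoc, add_comm (-1 : ℤ)] using this

end CesaroNull

/-- A finite measure on the circle whose Fourier coefficients are Cesàro null has no atoms. -/
theorem measure_singleton_eq_zero_of_isCesaroNull {σ : Measure Circle} [IsFiniteMeasure σ]
    (h : IsCesaroNull fun n : ℤ => ∫ u : Circle, (u : ℂ) ^ n ∂σ) (z : Circle) : σ {z} = 0 := by
  set ψ : ℤ → ℂ := fun n : ℤ => ∫ u : Circle, (u : ℂ) ^ n ∂σ with hψ
  have hcont : ∀ n : ℤ, Continuous fun u : Circle => (u : ℂ) ^ n := fun n => by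
    simp_rw [← Circle.coe_zpow]
    exact continuous_subtype_val.comp (continuous_zpow n)
  have hint : ∀ n : ℤ, Integrable (fun u : Circle => (u : ℂ) ^ n) σ := fun n =>
    Integrable.of_bound (hcont n).aestronglyMeasurable 1 (.of_forall fun u => by simp [Circle.norm_coe])
  have key : ∀ N : ℕ, 0 < N → σ.real {z} ≤ fejerMean ψ N := by
    intro N hN
    -- The kernel `|∑ (u / z) ^ a| ^ 2` is `N ^ 2` at `u = z`, and nonnegative elsewhere.
    let D : Circle → ℂ := fun u => ∑ a ∈ Finset.range N, ((u : ℂ) * (z : ℂ)⁻¹) ^ a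
    have hD : ∀ u, ((‖D u‖ ^ 2 : ℝ) : ℂ) = ∑ a ∈ Finset.range N, ∑ b ∈ Finset.range N,
        (z : ℂ) ^ (-((a : ℤ) - b)) * (u : ℂ) ^ ((a : ℤ) - b) := by
      intro u
      rw [Complex.ofReal_pow, ← Complex.mul_conj', map_sum, Finset.sum_mul_sum]
      refine Finset.sum_congr rfl fun a _ => Finset.sum_congr rfl fun b _ => ?_
      have hu := u.coe_ne_zero
      have hz := z.coe_ne_zero
      rw [map_pow, map_mul, ← Circle.coe_inv, ← Circle.coe_inv_eq_conj, ← Circle.coe_inv_eq_conj,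
        inv_inv, zpow_neg, zpow_sub₀ hz, zpow_sub₀ hu]
      simp only [zpow_natCast, Circle.coe_inv, mul_pow, inv_pow]
      field_simp
    have hDc : Continuous D := by
      simp only [D, ← Circle.coe_inv]; fun_prop
    have hDN : ∀ u, ‖D u‖ ≤ N := fun u => by
      refine (norm_sum_le _ _).trans ?_
      simp [Circle.norm_coe, ← Circle.coe_inv]
    have hDint : Integrable (fun u => ‖D u‖ ^ 2) σ :=
      Integrable.of_bound (by fun_prop) ((N : ℝ) ^ 2) (.of_forall fun u => by
        simp only [norm_pow, norm_norm]
        gcongr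
        exact hDN u)
    have h1 : (N : ℝ) ^ 2 * σ.real {z} ≤ ∫ u, ‖D u‖ ^ 2 ∂σ := by
      calc (N : ℝ) ^ 2 * σ.real {z} = ∫ u in {z}, ‖D u‖ ^ 2 ∂σ := by
            rw [setIntegral_congr_fun (g := fun _ => (N : ℝ) ^ 2) (measurableSet_singleton z)]
            · simp [mul_comm, measureReal_def]
            · rintro u rfl
              simp [D]
        _ ≤ _ := setIntegral_le_integral hDint (.of_forall fun u => by positivity)
    have h2 : ((∫ u, ‖D u‖ ^ 2 ∂σ : ℝ) : ℂ) = ∑ a ∈ Finset.range N, ∑ b ∈ Finset.range N,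
        (z : ℂ) ^ (-((a : ℤ) - b)) * ψ ((a : ℤ) - b) := by
      rw [← integral_complex_ofReal]
      simp_rw [hD]
      rw [integral_finsetSum _ fun a _ => integrable_finsetSum _ fun b _ => (hint _).const_mul _]
      refine Finset.sum_congr rfl fun a _ => ?_
      rw [integral_finsetSum _ fun b _ => (hint _).const_mul _]
      exact Finset.sum_congr rfl fun b _ => integral_const_mul _ _
    have h3 : ∫ u, ‖D u‖ ^ 2 ∂σ ≤ ∑ a ∈ Finset.range N, ∑ b ∈ Finset.range N, ‖ψ (a - b)‖ := by
      calc _ ≤ ‖((∫ u, ‖D u‖ ^ 2 ∂σ : ℝ) : ℂ)‖ := by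
            rw [Complex.norm_real]; exact le_abs_self _
        _ ≤ _ := by
          rw [h2]
          refine (norm_sum_le _ _).trans (Finset.sum_le_sum fun a _ => (norm_sum_le _ _).trans
            (Finset.sum_le_sum fun b _ => ?_))
          simp [Circle.norm_coe]
    rw [fejerMean, le_div_iff₀ (by positivity)]
    linarith
  have h0 : σ.real {z} ≤ 0 :=
    ge_of_tendsto h ((eventually_gt_atTop 0).mono key)
  have := le_antisymm h0 measureReal_nonneg
  simpa [measureReal_def, ENNReal.toReal_eq_zero_iff] using this

/-! ### Density of characters and transfer to Hilbert space -/

section Density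

variable {ι : Type*} [Countable ι] {P : Measure (ι → ℝ)}

/-- A real integrable function that is orthogonal to all the characters `expChar c` vanishes. -/
theorem ae_eq_zero_of_integral_mul_expChar {u : (ι → ℝ) → ℝ} (hu : Integrable u P)
    (h : ∀ c : ι →₀ ℝ, ∫ x, (u x : ℂ) * expChar c x ∂P = 0) : u =ᵐ[P] 0 := by
  -- The positive and negative parts of `u` are densities of measures with the same
  -- characteristic functional.
  obtain ⟨v, hvm, hv⟩ := hu.1.aemeasurable
  have hvi : Integrable v P := hu.congr hv
  let ν : ((ι → ℝ) → ℝ) → Measure (ι → ℝ) := fun g => P.withDensity fun x => ENNReal.ofReal (g x)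
  have hfin : ∀ g, Integrable g P → IsFiniteMeasure (ν g) := fun g hg => by
    refine isFiniteMeasure_withDensity ?_
    exact (hg.lintegral_lt_top).ne
  have hint : ∀ g, Measurable g → ∀ c : ι →₀ ℝ,
      ∫ x, expChar c x ∂ν g = ∫ x, ((max (g x) 0 : ℝ) : ℂ) * expChar c x ∂P := fun g hg c => by
    simp only [ν]
    have := integral_withDensity_eq_integral_smul (μ := P) (f := fun x => (g x).toNNReal)
      hg.real_toNNReal (expChar c)
    refine this.trans (integral_congr_ae (.of_forall fun x => ?_))
    simp [NNReal.smul_def]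
  have := hfin v hvi
  have := hfin _ hvi.neg
  have hmul : ∀ g : (ι → ℝ) → ℝ, Integrable g P → ∀ c : ι →₀ ℝ,
      Integrable (fun x => (g x : ℂ) * expChar c x) P := fun g hg c =>
    (show Integrable (fun x => (g x : ℂ)) P from hg.ofReal).mul_bdd (c := 1) (continuous_expChar c).aestronglyMeasurable
      (.of_forall fun x => (norm_expChar c x).le)
  have heq : ν v = ν (-v) := by
    refine measure_ext_of_expChar fun c => ?_
    rw [hint v hvm, hint _ hvm.neg, ← sub_eq_zero,
      ← integral_sub (hmul _ hvi.pos_part c) (hmul _ hvi.neg.pos_part c), ← h c]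
    refine integral_congr_ae ?_
    filter_upwards [hv] with x hx
    rw [hx, ← sub_mul, ← Complex.ofReal_sub]
    congr 2
    simp only [Pi.neg_apply]
    rcases le_total (v x) 0 with h0 | h0
    · rw [max_eq_right h0, max_eq_left (by linarith)]; ring
    · rw [max_eq_left h0, max_eq_right (by linarith)]; ring
  have h1 := (withDensity_eq_iff (by fun_prop) (by fun_prop)
    (hvi.lintegral_lt_top).ne).1 heq
  filter_upwards [hv, h1] with x hx hx1
  rw [hx]
  simp only [Pi.neg_apply, Pi.zero_apply] at hx1 ⊢
  rcases lt_trichotomy (v x) 0 with h0 | h0 | h0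
  · rw [ENNReal.ofReal_of_nonpos h0.le, eq_comm, ENNReal.ofReal_eq_zero] at hx1; linarith
  · exact h0
  · rw [ENNReal.ofReal_of_nonpos (p := - v x) (by linarith), ENNReal.ofReal_eq_zero] at hx1; linarith

variable [IsProbabilityMeasure P]

theorem memLp_expChar (P : Measure (ι → ℝ)) [IsProbabilityMeasure P] (c : ι →₀ ℝ) :
    MemLp (expChar c) 2 P :=
  MemLp.of_bound (continuous_expChar c).aestronglyMeasurable 1
    (.of_forall fun x => (norm_expChar c x).le)

/-- The class of `expChar c` in `L²`. -/
noncomputable def expLp (P : Measure (ι → ℝ)) [IsProbabilityMeasure P] (c : ι →₀ ℝ) :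
    Lp ℂ 2 P := (memLp_expChar P c).toLp

/-- The characters span a dense subspace of `L²`. -/
theorem span_expLp_dense :
    (Submodule.span ℂ (Set.range (expLp P))).topologicalClosure = ⊤ := by
  rw [Submodule.topologicalClosure_eq_top_iff, Submodule.eq_bot_iff]
  intro h hh
  have hi : Integrable h P := (Lp.memLp h).integrable one_le_two
  have h0 : ∀ c : ι →₀ ℝ, ∫ x, h x * expChar c x ∂P = 0 := by
    intro c
    have h1 := (Submodule.mem_orthogonal _ _).1 hh (expLp P (-c)) (Submodule.subset_span ⟨_, rfl⟩)
    rw [L2.inner_def] at h1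
    rw [← h1]
    refine integral_congr_ae ?_
    filter_upwards [(memLp_expChar P (-c)).coeFn_toLp] with x hx
    rw [expLp, hx, RCLike.inner_apply, conj_expChar, neg_neg]
  have hmul : ∀ c : ι →₀ ℝ, ∀ g : (ι → ℝ) → ℂ, Integrable g P →
      Integrable (fun x => g x * expChar c x) P := fun c g hg =>
    hg.mul_bdd (c := 1) (continuous_expChar c).aestronglyMeasurable
      (.of_forall fun x => (norm_expChar c x).le)
  have hic : Integrable (fun x => conj (h x)) P := by
    simpa using hi.norm.mono' (by fun_prop) (.of_forall fun x => by simp)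
  have h0' : ∀ c : ι →₀ ℝ, ∫ x, conj (h x) * expChar c x ∂P = 0 := by
    intro c
    have : ∀ x, conj (h x) * expChar c x = conj (h x * expChar (-c) x) := fun x => by
      rw [map_mul, conj_expChar, neg_neg]
    simp_rw [this]
    rw [integral_conj, h0, map_zero]
  have hre : (fun x => (h x).re) =ᵐ[P] 0 := by
    refine ae_eq_zero_of_integral_mul_expChar hi.re fun c => ?_
    have : ∀ x, (((h x).re : ℝ) : ℂ) * expChar c x =
        (1 / 2) * (h x * expChar c x + conj (h x) * expChar c x) := fun x => by
      rw [Complex.re_eq_add_conj]; ring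
    simp_rw [this]
    rw [integral_const_mul, integral_add (hmul c _ hi) (hmul c _ hic), h0, h0']
    simp
  have him : (fun x => (h x).im) =ᵐ[P] 0 := by
    refine ae_eq_zero_of_integral_mul_expChar hi.im fun c => ?_
    have : ∀ x, (((h x).im : ℝ) : ℂ) * expChar c x =
        (1 / (2 * Complex.I)) * (h x * expChar c x - conj (h x) * expChar c x) := fun x => by
      rw [Complex.im_eq_sub_conj]; ring
    simp_rw [this]
    rw [integral_const_mul, integral_sub (hmul c _ hi) (hmul c _ hic), h0, h0']
    simp
  rw [Lp.eq_zero_iff_ae_eq_zero]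
  filter_upwards [hre, him] with x h1 h2
  exact Complex.ext h1 h2

end Density

section Hilbert

variable {H : Type*} [NormedAddCommGroup H] [InnerProductSpace ℂ H]

/-- Decorrelation on average passes from a set with dense span to the whole space: here `e` stands
for the unit vector of constants, and `U n` for the powers of the Koopman operator. -/
theorem isCesaroNull_inner_of_dense {U : ℤ → H →ₗᵢ[ℂ] H} {e : H} (he : ‖e‖ = 1) {S : Set H}
    (hS : (Submodule.span ℂ S).topologicalClosure = ⊤)
    (h : ∀ f ∈ S, ∀ g ∈ S, IsCesaroNull fun n =>
      inner ℂ g (U n f) - inner ℂ g e * inner ℂ e f) (f g : H) :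
    IsCesaroNull fun n => inner ℂ g (U n f) - inner ℂ g e * inner ℂ e f := by
  set B : ℤ → H → H → ℂ := fun n f g => inner ℂ g (U n f) - inner ℂ g e * inner ℂ e f with hB
  have hBle : ∀ n f g, ‖B n f g‖ ≤ 2 * ‖f‖ * ‖g‖ := by
    intro n f g
    have h1 := norm_inner_le_norm (𝕜 := ℂ) g (U n f)
    rw [LinearIsometry.norm_map] at h1
    have h2 : ‖inner ℂ g e * inner ℂ e f‖ ≤ ‖g‖ * ‖f‖ := by
      rw [norm_mul]
      have h3 := norm_inner_le_norm (𝕜 := ℂ) g e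
      have h4 := norm_inner_le_norm (𝕜 := ℂ) e f
      rw [he] at h3 h4
      nlinarith [norm_nonneg (inner ℂ g e), norm_nonneg (inner ℂ e f), norm_nonneg g, norm_nonneg f]
    refine (norm_sub_le _ _).trans ?_
    nlinarith
  have hadd1 : ∀ n f f' g, B n (f + f') g = B n f g + B n f' g := fun n f f' g => by
    simp only [hB, map_add, inner_add_right]; ring
  have hadd2 : ∀ n f g g', B n f (g + g') = B n f g + B n f g' := fun n f g g' => by
    simp only [hB, inner_add_left]; ring
  have hsub1 : ∀ n f f' g, B n (f - f') g = B n f g - B n f' g := fun n f f' g => by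
    simp only [hB, map_sub, inner_sub_right]; ring
  have hsub2 : ∀ n f g g', B n f (g - g') = B n f g - B n f g' := fun n f g g' => by
    simp only [hB, inner_sub_left]; ring
  have hsmul1 : ∀ n (a : ℂ) f g, ‖B n (a • f) g‖ = ‖‖a‖ * ‖B n f g‖‖ := fun n a f g => by
    rw [norm_mul, norm_norm, norm_norm, ← norm_mul]
    simp only [hB, map_smul, inner_smul_right]; congr 1; ring
  have hsmul2 : ∀ n (a : ℂ) f g, ‖B n f (a • g)‖ = ‖‖a‖ * ‖B n f g‖‖ := fun n a f g => by
    rw [norm_mul, norm_norm, norm_norm, ← RCLike.norm_conj a, ← norm_mul]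
    simp only [hB, inner_smul_left]; congr 1; ring
  have hnorm : ∀ f g, IsCesaroNull (fun n => B n f g) → IsCesaroNull fun n => ‖B n f g‖ :=
    fun f g h => h.mono fun n => by simp
  have hmem : ∀ f : H, ∀ ε > 0, ∃ f' ∈ Submodule.span ℂ S, ‖f - f'‖ < ε := by
    intro f ε hε
    have : f ∈ (Submodule.span ℂ S).topologicalClosure := by rw [hS]; trivial
    obtain ⟨f', h1, h2⟩ := Metric.mem_closure_iff.1 this ε hε
    exact ⟨f', h1, by rwa [← dist_eq_norm]⟩
  have step1 : ∀ g ∈ S, ∀ f ∈ Submodule.span ℂ S, IsCesaroNull fun n => B n f g := by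
    intro g hg f hf
    induction hf using Submodule.span_induction with
    | mem f hf => exact h f hf g hg
    | zero => simpa [hB] using isCesaroNull_zero
    | add f f' _ _ h1 h2 => simpa only [hadd1] using h1.add h2
    | smul a f _ h1 => exact ((hnorm f g h1).const_mul ‖a‖).mono fun n => (hsmul1 n a f g).le
  have step2 : ∀ g ∈ S, ∀ f, IsCesaroNull fun n => B n f g := by
    intro g hg f
    refine isCesaroNull_of_approx fun ε hε => ?_
    obtain ⟨f', hf', hff'⟩ := hmem f (ε / (2 * (‖g‖ + 1))) (by positivity)
    refine ⟨fun n => B n f' g, step1 g hg f' hf', fun n => ?_⟩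
    rw [← hsub1]
    refine (hBle _ _ _).trans ?_
    rw [lt_div_iff₀ (by positivity)] at hff'
    nlinarith [norm_nonneg (f - f'), norm_nonneg g]
  have step3 : ∀ f, ∀ g ∈ Submodule.span ℂ S, IsCesaroNull fun n => B n f g := by
    intro f g hg
    induction hg using Submodule.span_induction with
    | mem g hg => exact step2 g hg f
    | zero => simpa [hB] using isCesaroNull_zero
    | add g g' _ _ h1 h2 => simpa only [hadd2] using h1.add h2
    | smul a g _ h1 => exact ((hnorm f g h1).const_mul ‖a‖).mono fun n => (hsmul2 n a f g).le
  refine isCesaroNull_of_approx fun ε hε => ?_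
  obtain ⟨g', hg', hgg'⟩ := hmem g (ε / (2 * (‖f‖ + 1))) (by positivity)
  refine ⟨fun n => B n f g', step3 f g' hg', fun n => ?_⟩
  rw [← hsub2]
  refine (hBle _ _ _).trans ?_
  rw [lt_div_iff₀ (by positivity)] at hgg'
  nlinarith [norm_nonneg (g - g'), norm_nonneg f]

/-- Strong convergence of linear isometries to the identity need only be checked on a set with
dense span. -/
theorem tendsto_isometry_of_dense {U : ℕ → H →ₗᵢ[ℂ] H} {S : Set H}
    (hS : (Submodule.span ℂ S).topologicalClosure = ⊤)
    (h : ∀ f ∈ S, Tendsto (fun k => U k f) atTop (𝓝 f)) (f : H) :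
    Tendsto (fun k => U k f) atTop (𝓝 f) := by
  have hspan : ∀ f ∈ Submodule.span ℂ S, Tendsto (fun k => U k f) atTop (𝓝 f) := by
    intro f hf
    induction hf using Submodule.span_induction with
    | mem f hf => exact h f hf
    | zero => simp
    | add f f' _ _ h1 h2 => simpa using h1.add h2
    | smul a f _ h1 => simpa using h1.const_smul a
  rw [Metric.tendsto_atTop]
  intro ε hε
  have : f ∈ (Submodule.span ℂ S).topologicalClosure := by rw [hS]; trivial
  obtain ⟨f', h1, h2⟩ := Metric.mem_closure_iff.1 this (ε / 3) (by positivity)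
  obtain ⟨N, hN⟩ := Metric.tendsto_atTop.1 (hspan f' h1) (ε / 3) (by positivity)
  refine ⟨N, fun n hn => ?_⟩
  calc dist (U n f) f ≤ dist (U n f) (U n f') + dist (U n f') f' + dist f' f :=
        dist_triangle4 _ _ _ _
    _ < ε / 3 + ε / 3 + ε / 3 := by
        rw [(U n).dist_map, dist_comm f' f]
        have := hN n hn
        linarith
    _ = ε := by ring

end Hilbert

/-! ### The Gaussian shift -/

section Shift

/-- The shift on `ℤ → ℝ`. -/
def shift : (ℤ → ℝ) ≃ᵐ (ℤ → ℝ) where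
  toFun x m := x (m + 1)
  invFun x m := x (m - 1)
  left_inv x := by funext m; simp
  right_inv x := by funext m; simp
  measurable_toFun := measurable_pi_lambda _ fun m => measurable_pi_apply _
  measurable_invFun := measurable_pi_lambda _ fun m => measurable_pi_apply _

theorem iter_shift (n : ℤ) (x : ℤ → ℝ) : iter shift n x = fun m => x (m + n) := by
  induction n using Int.induction_on generalizing x with
  | zero => simp [iter]
  | succ i ih =>
    have : iter shift (i + 1) x = iter shift i (shift x) := by
      simp [iter, zpow_add]
    rw [this, ih]
    funext m
    change x (m + i + 1) = _
    rw [add_assoc]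
  | pred i ih =>
    have : iter shift (-i - 1) x = iter shift (-i) (shift.symm x) := by
      simp [iter, zpow_sub]
    rw [this, ih]
    funext m
    change x (m + -i - 1) = _
    congr 1
    ring

/-- Translation of the coefficients by `n`. -/
noncomputable def translateCoeff (n : ℤ) (c : ℤ →₀ ℝ) : ℤ →₀ ℝ := c.mapDomain (· + n)

theorem expChar_iter_shift (n : ℤ) (c : ℤ →₀ ℝ) (x : ℤ → ℝ) :
    expChar c (iter shift n x) = expChar (translateCoeff n c) x := by
  rw [expChar, expChar, pairing, pairing, translateCoeff, Finsupp.linearCombination_mapDomain, iter_shift]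
  rfl

section covForm

variable {ι : Type*} (K : Matrix ι ι ℝ)

theorem covForm_add_left (c c' d : ι →₀ ℝ) :
    covForm K (c + c') d = covForm K c d + covForm K c' d := by
  classical
  rw [covForm, Finsupp.sum_add_index]
  · rfl
  · simp
  · intro i _ a b; rw [← Finsupp.sum_add]; congr; funext; ring

theorem covForm_add_right (c d d' : ι →₀ ℝ) :
    covForm K c (d + d') = covForm K c d + covForm K c d' := by
  classical
  rw [covForm, covForm, covForm, ← Finsupp.sum_add]
  congr
  funext a s
  rw [Finsupp.sum_add_index]
  · simp
  · intro i _ a b; ring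

theorem covForm_neg_left (c d : ι →₀ ℝ) : covForm K (-c) d = -covForm K c d := by
  have := covForm_add_left K c (-c) d
  rw [add_neg_cancel] at this
  have h0 : covForm K 0 d = 0 := by simp [covForm]
  linarith

theorem covForm_neg_right (c d : ι →₀ ℝ) : covForm K c (-d) = -covForm K c d := by
  have := covForm_add_right K c d (-d)
  rw [add_neg_cancel] at this
  have h0 : covForm K c 0 = 0 := by simp [covForm]
  linarith

theorem covForm_comm {K : Matrix ι ι ℝ} (hK : K.IsHermitian) (c d : ι →₀ ℝ) :
    covForm K c d = covForm K d c := by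
  rw [covForm_eq_sum K c d subset_rfl subset_rfl, covForm_eq_sum K d c subset_rfl subset_rfl,
    Finset.sum_comm]
  refine Finset.sum_congr rfl fun i _ => Finset.sum_congr rfl fun j _ => ?_
  have : K j i = K i j := by simpa using hK.apply i j
  rw [this]; ring

end covForm

/-- The covariance matrix of a stationary process with autocovariance `φ`. -/
def toeplitz (φ : ℤ → ℝ) : Matrix ℤ ℤ ℝ := Matrix.of fun a b => φ (a - b)

theorem toeplitz_apply (φ : ℤ → ℝ) (a b : ℤ) : toeplitz φ a b = φ (a - b) := rfl

theorem covForm_translate_left (φ : ℤ → ℝ) (n : ℤ) (c d : ℤ →₀ ℝ) :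
    covForm (toeplitz φ) (translateCoeff n c) d =
      ∑ a ∈ c.support, ∑ b ∈ d.support, c a * d b * φ (n + (a - b)) := by
  rw [covForm, translateCoeff, Finsupp.sum_mapDomain_index]
  · refine Finset.sum_congr rfl fun a _ => Finset.sum_congr rfl fun b _ => ?_
    beta_reduce
    rw [toeplitz_apply, show a + n - b = n + (a - b) by ring]; ring
  · simp
  · intro b m₁ m₂
    rw [← Finsupp.sum_add]; congr; funext; ring

theorem covForm_translate (φ : ℤ → ℝ) (n : ℤ) (c : ℤ →₀ ℝ) :
    covForm (toeplitz φ) (translateCoeff n c) (translateCoeff n c) = covForm (toeplitz φ) c c := by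
  rw [covForm, translateCoeff, Finsupp.sum_mapDomain_index]
  · refine Finset.sum_congr rfl fun a _ => ?_
    beta_reduce
    rw [Finsupp.sum_mapDomain_index]
    · refine Finset.sum_congr rfl fun b _ => ?_
      simp [toeplitz_apply]
    · simp
    · intros; ring
  · simp
  · intro b m₁ m₂
    rw [← Finsupp.sum_add]; congr; funext; ring

end Shift

section GaussianShift

variable {φ : ℤ → ℝ} {P : Measure (ℤ → ℝ)} [IsProbabilityMeasure P]

theorem measurePreserving_shift
    (hP : ∀ c, ∫ x, expChar c x ∂P = Complex.exp (-(covForm (toeplitz φ) c c) / 2)) (n : ℤ) :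
    MeasurePreserving (iter shift n) P P := by
  have hm : Measurable (iter shift n) := by
    have : iter shift n = fun x m => x (m + n) := funext fun x => iter_shift n x
    rw [this]
    exact measurable_pi_lambda _ fun m => measurable_pi_apply _
  refine ⟨hm, ?_⟩
  have : IsProbabilityMeasure (P.map (iter shift n)) :=
    Measure.isProbabilityMeasure_map hm.aemeasurable
  refine measure_ext_of_expChar fun c => ?_
  rw [integral_map hm.aemeasurable (continuous_expChar c).aestronglyMeasurable]
  simp_rw [expChar_iter_shift]
  rw [hP, hP, covForm_translate]

theorem inner_expLp (hφ : (toeplitz φ).PosSemidef)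
    (hP : ∀ c, ∫ x, expChar c x ∂P = Complex.exp (-(covForm (toeplitz φ) c c) / 2))
    (c d : ℤ →₀ ℝ) : inner ℂ (expLp P d) (expLp P c) =
      Complex.exp (-(covForm (toeplitz φ) c c + covForm (toeplitz φ) d d) / 2 +
        covForm (toeplitz φ) c d) := by
  rw [L2.inner_def]
  have h : ∫ x, inner ℂ (expLp P d x) (expLp P c x) ∂P = ∫ x, expChar (c + -d) x ∂P := by
    refine integral_congr_ae ?_
    filter_upwards [(memLp_expChar P c).coeFn_toLp, (memLp_expChar P d).coeFn_toLp] with x hx hy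
    rw [expLp, expLp, hx, hy, RCLike.inner_apply, conj_expChar, expChar_add]
  rw [h, hP]
  congr 1
  rw [covForm_add_left, covForm_add_right, covForm_add_right, covForm_neg_left, covForm_neg_left,
    covForm_neg_right, covForm_neg_right, covForm_comm hφ.1 d c]
  push_cast
  ring

/-- The Koopman operators of the shift. -/
noncomputable def koopman
    (hP : ∀ c, ∫ x, expChar c x ∂P = Complex.exp (-(covForm (toeplitz φ) c c) / 2)) (n : ℤ) :
    Lp ℂ 2 P →ₗᵢ[ℂ] Lp ℂ 2 P :=
  Lp.compMeasurePreservingₗᵢ ℂ (iter shift n) (measurePreserving_shift hP n)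

theorem koopman_expLp
    (hP : ∀ c, ∫ x, expChar c x ∂P = Complex.exp (-(covForm (toeplitz φ) c c) / 2))
    (n : ℤ) (c : ℤ →₀ ℝ) : koopman hP n (expLp P c) = expLp P (translateCoeff n c) := by
  have hmp := measurePreserving_shift hP n
  have h1 : koopman hP n (expLp P c) =ᵐ[P] (expLp P c) ∘ iter shift n :=
    Lp.coeFn_compMeasurePreserving (expLp P c) hmp
  refine Lp.ext (h1.trans ?_)
  filter_upwards [(memLp_expChar P (translateCoeff n c)).coeFn_toLp,
    hmp.quasiMeasurePreserving.ae ((memLp_expChar P c).coeFn_toLp)] with x hx hy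
  rw [expLp, expLp, hx, Function.comp_apply, hy, expChar_iter_shift]

theorem norm_cexp_sub_one_le (t : ℝ) : ‖Complex.exp t - 1‖ ≤ |t| * Real.exp |t| := by
  rw [← Complex.ofReal_exp, ← Complex.ofReal_one, ← Complex.ofReal_sub, Complex.norm_real,
    Real.norm_eq_abs, abs_le]
  have h1 := Real.add_one_le_exp t
  have h2 := Real.add_one_le_exp (-t)
  have h3 : 1 ≤ Real.exp |t| := Real.one_le_exp (abs_nonneg t)
  constructor
  · nlinarith [neg_abs_le t, abs_nonneg t]
  · have h4 : Real.exp t - 1 ≤ t * Real.exp t := by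
      have := mul_le_mul_of_nonneg_right h2 (Real.exp_pos t).le
      rw [← Real.exp_add, neg_add_cancel, Real.exp_zero] at this
      linarith
    refine h4.trans ?_
    gcongr
    · exact le_abs_self t
    · exact le_abs_self t

/-- Characters are decorrelated by the Gaussian shift when the autocovariance is Cesàro null. -/
theorem isCesaroNull_inner_expLp (hφ : (toeplitz φ).PosSemidef)
    (hP : ∀ c, ∫ x, expChar c x ∂P = Complex.exp (-(covForm (toeplitz φ) c c) / 2))
    (hb : ∀ n, |φ n| ≤ 1) (hnull : IsCesaroNull φ) (c d : ℤ →₀ ℝ) :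
    IsCesaroNull fun n => inner ℂ (expLp P d) (koopman hP n (expLp P c)) -
      inner ℂ (expLp P d) (expLp P 0) * inner ℂ (expLp P 0) (expLp P c) := by
  set B : ℤ → ℝ := fun n => covForm (toeplitz φ) (translateCoeff n c) d with hB
  set m : ℂ := Complex.exp (-(covForm (toeplitz φ) c c + covForm (toeplitz φ) d d) / 2) with hm
  have hBnull : IsCesaroNull B := by
    simp_rw [hB, covForm_translate_left]
    exact IsCesaroNull.sum _ fun a _ => IsCesaroNull.sum _ fun b _ =>
      (hnull.comp_add hb _).const_mul _
  obtain ⟨C, hC⟩ : ∃ C, ∀ n, |B n| ≤ C := by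
    refine ⟨∑ a ∈ c.support, ∑ b ∈ d.support, |c a * d b|, fun n => ?_⟩
    simp_rw [hB, covForm_translate_left]
    refine (Finset.abs_sum_le_sum_abs _ _).trans (Finset.sum_le_sum fun a _ =>
      (Finset.abs_sum_le_sum_abs _ _).trans (Finset.sum_le_sum fun b _ => ?_))
    rw [abs_mul]
    exact mul_le_of_le_one_right (abs_nonneg _) (hb _)
  refine (hBnull.const_mul (‖m‖ * Real.exp C)).mono fun n => ?_
  have h0 : ∀ e, covForm (toeplitz φ) e 0 = 0 := fun e => by simp [covForm]
  have h0' : ∀ e, covForm (toeplitz φ) 0 e = 0 := fun e => by simp [covForm]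
  have h1 : inner ℂ (expLp P d) (koopman hP n (expLp P c)) -
      inner ℂ (expLp P d) (expLp P 0) * inner ℂ (expLp P 0) (expLp P c) =
      m * (Complex.exp (B n) - 1) := by
    rw [koopman_expLp, inner_expLp hφ hP, inner_expLp hφ hP, inner_expLp hφ hP, covForm_translate]
    simp only [h0, h0']
    rw [← Complex.exp_add, mul_sub, mul_one, hm, hB, ← Complex.exp_add]
    congr 2
    push_cast
    ring
  rw [h1, norm_mul, norm_mul, norm_mul, norm_norm, mul_assoc]
  refine mul_le_mul_of_nonneg_left ((norm_cexp_sub_one_le _).trans ?_) (norm_nonneg _)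
  rw [mul_comm, Real.norm_eq_abs, Real.norm_eq_abs, abs_of_pos (Real.exp_pos C)]
  gcongr
  exact hC n

/-- The correlations `n ↦ ⟨Uⁿ f, f⟩` are Cesàro null for every `f` of mean zero, by density of the
characters, so the spectral measures have no atoms. -/
theorem isWeaklyMixing_shift (hφ : (toeplitz φ).PosSemidef)
    (hP : ∀ c, ∫ x, expChar c x ∂P = Complex.exp (-(covForm (toeplitz φ) c c) / 2))
    (hb : ∀ n, |φ n| ≤ 1) (hnull : IsCesaroNull φ) : IsWeaklyMixing P shift := by
  intro f hf hf0 σ hσ z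
  have := hσ.1
  refine measure_singleton_eq_zero_of_isCesaroNull ?_ z
  simp_rw [hσ.2]
  set F : Lp ℂ 2 P := hf.toLp
  have h1 : ‖expLp P 0‖ = 1 := by
    have h2 := inner_expLp hφ hP 0 0
    rw [inner_self_eq_norm_sq_to_K] at h2
    simp only [covForm, Finsupp.sum_zero_index, Complex.ofReal_zero, add_zero, neg_zero, zero_div,
      Complex.exp_zero] at h2
    have h3 : ‖expLp P 0‖ ^ 2 = 1 := by
      rw [← RCLike.ofReal_pow] at h2
      exact RCLike.ofReal_injective (K := ℂ) (h2.trans (by simp))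
    nlinarith [norm_nonneg (expLp P 0)]
  have h2 := isCesaroNull_inner_of_dense (U := koopman hP) h1 span_expLp_dense (by
    rintro _ ⟨c, rfl⟩ _ ⟨d, rfl⟩
    exact isCesaroNull_inner_expLp hφ hP hb hnull c d) F F
  have h3 : inner ℂ (expLp P 0) F = 0 := by
    rw [L2.inner_def, ← hf0]
    refine integral_congr_ae ?_
    filter_upwards [(memLp_expChar P 0).coeFn_toLp, hf.coeFn_toLp] with x hx hy
    rw [expLp, hx, hy, RCLike.inner_apply, conj_expChar]
    simp [expChar, pairing]
  rw [h3] at h2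
  simp only [mul_zero, sub_zero] at h2
  refine h2.mono fun n => le_of_eq ?_
  congr 1
  rw [L2.inner_def]
  refine integral_congr_ae ?_
  have hmp := measurePreserving_shift hP n
  have h4 : koopman hP n F =ᵐ[P] F ∘ iter shift n := Lp.coeFn_compMeasurePreserving F hmp
  filter_upwards [h4, hf.coeFn_toLp, hmp.quasiMeasurePreserving.ae hf.coeFn_toLp] with x hx hy hz
  rw [hx, Function.comp_apply, hy, hz, RCLike.inner_apply]

/-- If `φ (n k + t) → φ t` then the Koopman operators of index `n k` converge strongly to the identity,
first on the characters and then, by density, on indicator functions. -/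
theorem isRigidFor_shift (hφ : (toeplitz φ).PosSemidef)
    (hP : ∀ c, ∫ x, expChar c x ∂P = Complex.exp (-(covForm (toeplitz φ) c c) / 2))
    {n : ℕ → ℤ} (hn : ∀ t, Tendsto (fun k => φ (n k + t)) atTop (𝓝 (φ t))) :
    IsRigidFor P shift n := by
  have hexp : ∀ c, Tendsto (fun k => koopman hP (n k) (expLp P c)) atTop (𝓝 (expLp P c)) := by
    intro c
    have h1 : Tendsto (fun k => covForm (toeplitz φ) (translateCoeff (n k) c) c) atTop
        (𝓝 (covForm (toeplitz φ) c c)) := by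
      simp_rw [covForm_translate_left]
      rw [covForm_eq_sum _ c c subset_rfl subset_rfl]
      refine tendsto_finsetSum _ fun a _ => tendsto_finsetSum _ fun b _ => ?_
      have := (hn (a - b)).const_mul (c a * c b)
      convert this using 2
      simp [toeplitz]; ring
    have h2 : Tendsto (fun k => inner ℂ (expLp P c) (koopman hP (n k) (expLp P c))) atTop
        (𝓝 (inner ℂ (expLp P c) (expLp P c))) := by
      simp_rw [koopman_expLp, inner_expLp hφ hP, covForm_translate]
      refine (Complex.continuous_exp.tendsto _).comp (tendsto_const_nhds.add ?_)
      exact (Complex.continuous_ofReal.tendsto _).comp h1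
    rw [tendsto_iff_norm_sub_tendsto_zero]
    have h3 : ∀ k, ‖koopman hP (n k) (expLp P c) - expLp P c‖ =
        √(2 * ‖expLp P c‖ ^ 2 -
          2 * RCLike.re (inner ℂ (expLp P c) (koopman hP (n k) (expLp P c)))) := by
      intro k
      rw [← Real.sqrt_sq (norm_nonneg (koopman hP (n k) (expLp P c) - expLp P c)),
        @norm_sub_sq ℂ, LinearIsometry.norm_map, inner_re_symm]
      congr 1; ring
    simp_rw [h3]
    have h4 := ((RCLike.continuous_re.tendsto _).comp h2).const_mul 2
    have h5 := (Real.continuous_sqrt.tendsto _).comp ((tendsto_const_nhds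
      (x := 2 * ‖expLp P c‖ ^ 2)).sub h4)
    rw [inner_self_eq_norm_sq, sub_self, Real.sqrt_zero] at h5
    exact h5
  intro A hA
  have hlim := tendsto_isometry_of_dense (U := fun k => koopman hP (n k)) span_expLp_dense (by
    rintro _ ⟨c, rfl⟩
    exact hexp c) (indicatorConstLp 2 hA (measure_ne_top P A) 1)
  have hk : ∀ k, koopman hP (n k) (indicatorConstLp 2 hA (measure_ne_top P A) 1) =
      indicatorConstLp 2 ((measurePreserving_shift hP (n k)).measurable hA)
        (measure_ne_top P _) 1 := by
    intro k
    exact (Lp.indicatorConstLp_compMeasurePreserving hA (measure_ne_top P A) 1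
      (measurePreserving_shift hP (n k))).symm
  rw [tendsto_iff_edist_tendsto_0] at hlim
  simp_rw [hk, edist_indicatorConstLp_eq_enorm] at hlim
  have h6 : ∀ k, ‖indicatorConstLp 2 (((measurePreserving_shift hP (n k)).measurable hA).symmDiff hA)
      (measure_ne_top P _) (1 : ℂ)‖ₑ ^ 2 = P (symmDiff (iter shift (n k) ⁻¹' A) A) := by
    intro k
    rw [← ofReal_norm, ← ENNReal.ofReal_pow (norm_nonneg _),
      norm_indicatorConstLp two_ne_zero ENNReal.ofNat_ne_top, norm_one, one_mul,
      ← Real.rpow_natCast, ← Real.rpow_mul measureReal_nonneg]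
    simp
  simp_rw [← h6]
  simpa using ENNReal.Tendsto.pow (n := 2) hlim

/-- The half-space of all `x` with `x 0 > 0` is a nontrivial event. -/
theorem exists_measure_pos_lt_one (hφ0 : φ 0 = 1)
    (hP : ∀ c, ∫ x, expChar c x ∂P = Complex.exp (-(covForm (toeplitz φ) c c) / 2)) :
    ∃ A : Set (ℤ → ℝ), MeasurableSet A ∧ 0 < P A ∧ P A < 1 := by
  have hlaw : P.map (fun x => x 0) = ProbabilityTheory.gaussianReal 0 1 := by
    have : IsProbabilityMeasure (P.map fun x => x 0) :=
      Measure.isProbabilityMeasure_map (measurable_pi_apply 0).aemeasurable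
    refine Measure.ext_of_charFun (funext fun t => ?_)
    rw [charFun_apply_real, ProbabilityTheory.charFun_gaussianReal,
      integral_map (measurable_pi_apply 0).aemeasurable (by fun_prop)]
    have := hP (Finsupp.single 0 t)
    simp only [expChar, pairing, Finsupp.linearCombination_single, smul_eq_mul] at this
    push_cast at this
    rw [this]
    congr 1
    simp [covForm, toeplitz, hφ0]
    ring
  have hpos : ∀ s : Set ℝ, volume s ≠ 0 → ProbabilityTheory.gaussianReal 0 1 s ≠ 0 := fun s hs h =>
    hs (ProbabilityTheory.gaussianReal_absolutelyContinuous' 0 one_ne_zero h)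
  refine ⟨(fun x => x 0) ⁻¹' Set.Ioi 0, measurable_pi_apply 0 measurableSet_Ioi, ?_, ?_⟩
  · rw [← Measure.map_apply (measurable_pi_apply 0) measurableSet_Ioi, hlaw]
    exact pos_iff_ne_zero.2 (hpos _ (by simp))
  · rw [← Measure.map_apply (measurable_pi_apply 0) measurableSet_Ioi, hlaw,
      ← compl_compl (Set.Ioi (0 : ℝ)), Set.compl_Ioi]
    refine lt_of_le_of_ne prob_le_one fun h => ?_
    rw [prob_compl_eq_one_iff measurableSet_Iic] at h
    exact hpos _ (by simp) h

/-- A sequence is a rigidity sequence as soon as some Cesàro null positive definite function tends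
to its value at `0` along the sequence. -/
theorem isRigiditySequence_of_posSemidef (hφ : (toeplitz φ).PosSemidef) (hφ0 : φ 0 = 1)
    (hb : ∀ n, |φ n| ≤ 1) (hnull : IsCesaroNull φ)
    {n : ℕ → ℤ} (hn : ∀ t, Tendsto (fun k => φ (n k + t)) atTop (𝓝 (φ t))) :
    IsRigiditySequence n := by
  obtain ⟨P, hP1, hP⟩ := exists_gaussianMeasure hφ
  have h1 := measurePreserving_shift hP 1
  have h2 : iter shift 1 = shift := by simp [iter]
  rw [h2] at h1
  exact ⟨ℤ → ℝ, inferInstance, P, shift, hP1, exists_measure_pos_lt_one hφ0 hP, h1,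
    isWeaklyMixing_shift hφ hP hb hnull, isRigidFor_shift hφ hP hn⟩

end GaussianShift

/-! ### Measures on the circle built from binary trees -/

section CirclePowers

theorem Circle.norm_coe_zpow (z : Circle) (n : ℤ) : ‖(z : ℂ) ^ n‖ = 1 := by
  rw [norm_zpow, Circle.norm_coe, one_zpow]

theorem Circle.norm_zpow_sub_zpow_le (u v : Circle) (n : ℤ) :
    ‖(u : ℂ) ^ n - (v : ℂ) ^ n‖ ≤ |(n : ℝ)| * ‖(u : ℂ) - v‖ := by
  have hnat : ∀ (u v : Circle) (k : ℕ), ‖(u : ℂ) ^ k - (v : ℂ) ^ k‖ ≤ k * ‖(u : ℂ) - v‖ := by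
    intro u v k
    induction k with
    | zero => simp
    | succ k ih =>
      have : (u : ℂ) ^ (k + 1) - (v : ℂ) ^ (k + 1) =
          u ^ k * ((u : ℂ) - v) + ((u : ℂ) ^ k - (v : ℂ) ^ k) * v := by ring
      rw [this]
      refine (norm_add_le _ _).trans ?_
      rw [norm_mul, norm_mul, norm_pow, Circle.norm_coe, Circle.norm_coe, one_pow]
      push_cast
      linarith
  rcases Int.eq_nat_or_neg n with ⟨k, rfl | rfl⟩
  · simpa using hnat u v k
  · have h : ∀ z : Circle, (z : ℂ) ^ (-(k : ℤ)) = ((z⁻¹ : Circle) : ℂ) ^ k := fun z => by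
      rw [zpow_neg, zpow_natCast, Circle.coe_inv, inv_pow]
    rw [h, h]
    refine (hnat _ _ k).trans (le_of_eq ?_)
    rw [Circle.coe_inv_eq_conj, Circle.coe_inv_eq_conj, ← map_sub, RCLike.norm_conj]
    simp

theorem Circle.norm_geom_sum_le (u : Circle) (N : ℕ) :
    ‖∑ a ∈ Finset.range N, (u : ℂ) ^ a‖ * ‖(u : ℂ) - 1‖ ≤ 2 := by
  rw [← norm_mul, geom_sum_mul]
  refine (norm_sub_le _ _).trans ?_
  rw [norm_pow, Circle.norm_coe, one_pow, norm_one]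
  norm_num

end CirclePowers

section Tree

/-- A sequence of points of the circle, seen as a binary tree: for `i < 2 ^ m` the point
`w (i + 2 ^ m)` is a new point near `w i`, so near that the points of index below `i + 2 ^ m` are
far apart in comparison. The first `2 ^ m` points are the vertices at level `m`, and the ancestor
at level `m` of the point of index `j` has index `j % 2 ^ m`. -/
structure IsTree (w : ℕ → Circle) : Prop where
  injective : Function.Injective w
  step : ∀ m i, i < 2 ^ m → ‖(w (i + 2 ^ m) : ℂ) - w i‖ ≤ (1 / 2) ^ (m + 1)
  sep : ∀ m i, i < 2 ^ m → ∀ a b, a < i + 2 ^ m → b < i + 2 ^ m → a ≠ b →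
    ‖(w (i + 2 ^ m) : ℂ) - w i‖ ≤ (1 / 2) ^ (m + 1) * (‖(w a : ℂ) - w b‖ / 4)

/-- The `n`-th Fourier coefficient of the uniform measure on the `2 ^ m` points at level `m`. -/
noncomputable def levelMean (w : ℕ → Circle) (m : ℕ) (n : ℤ) : ℂ :=
  (∑ i ∈ Finset.range (2 ^ m), (w i : ℂ) ^ n) / 2 ^ m

theorem sum_range_two_pow_succ {E : Type*} [AddCommMonoid E] (f : ℕ → E) (m : ℕ) :
    ∑ i ∈ Finset.range (2 ^ (m + 1)), f i =
      ∑ i ∈ Finset.range (2 ^ m), f i + ∑ i ∈ Finset.range (2 ^ m), f (i + 2 ^ m) := by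
  rw [pow_succ, mul_two, Finset.sum_range_add]
  simp_rw [add_comm (2 ^ m)]

theorem norm_levelMean_le (w : ℕ → Circle) (m : ℕ) (n : ℤ) : ‖levelMean w m n‖ ≤ 1 := by
  rw [levelMean, norm_div, norm_pow, Complex.norm_ofNat, div_le_one (by positivity)]
  refine (norm_sum_le _ _).trans ?_
  simp [Circle.norm_coe_zpow, -norm_zpow]

theorem IsTree.norm_levelMean_succ_sub_le {w : ℕ → Circle} (hw : IsTree w) (m : ℕ) (n : ℤ) :
    ‖levelMean w (m + 1) n - levelMean w m n‖ ≤ |(n : ℝ)| * (1 / 2) ^ m := by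
  have h : levelMean w (m + 1) n - levelMean w m n =
      (∑ i ∈ Finset.range (2 ^ m), ((w (i + 2 ^ m) : ℂ) ^ n - (w i : ℂ) ^ n)) / 2 ^ (m + 1) := by
    rw [levelMean, levelMean, sum_range_two_pow_succ, Finset.sum_sub_distrib]
    field_simp
    ring
  rw [h, norm_div, norm_pow, Complex.norm_ofNat, div_le_iff₀ (by positivity)]
  calc _ ≤ ∑ i ∈ Finset.range (2 ^ m), |(n : ℝ)| * (1 / 2) ^ (m + 1) := by
        refine (norm_sum_le _ _).trans (Finset.sum_le_sum fun i hi => ?_)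
        refine (Circle.norm_zpow_sub_zpow_le _ _ _).trans ?_
        gcongr
        exact hw.step m i (Finset.mem_range.1 hi)
    _ = |(n : ℝ)| * (1 / 2) := by
        simp only [Finset.sum_const, Finset.card_range, nsmul_eq_mul]
        push_cast
        rw [one_div, inv_pow]
        field_simp
        ring
    _ ≤ |(n : ℝ)| * 2 := by gcongr; norm_num
    _ = |(n : ℝ)| * (1 / 2) ^ m * 2 ^ (m + 1) := by
        rw [one_div, inv_pow]
        field_simp
        ring

theorem IsTree.exists_tendsto_levelMean {w : ℕ → Circle} (hw : IsTree w) :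
    ∃ ψ : ℤ → ℂ, ∀ n, Tendsto (fun m => levelMean w m n) atTop (𝓝 (ψ n)) := by
  have h : ∀ n, ∃ z, Tendsto (fun m => levelMean w m n) atTop (𝓝 z) := fun n =>
    cauchySeq_tendsto_of_complete <| cauchySeq_of_le_geometric (1 / 2) |(n : ℝ)| (by norm_num)
      fun m => by
        rw [dist_comm, dist_eq_norm]
        exact hw.norm_levelMean_succ_sub_le m n
  choose ψ hψ using h
  exact ⟨ψ, hψ⟩

/-- The Fourier coefficients of a limit of the uniform measures on the levels are positive definite. -/
theorem posSemidef_toeplitz_of_tendsto {w : ℕ → Circle} {ψ : ℤ → ℂ}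
    (hψ : ∀ n, Tendsto (fun m => levelMean w m n) atTop (𝓝 (ψ n))) :
    (toeplitz fun n => (ψ n).re).PosSemidef := by
  have hre : ∀ n, Tendsto (fun m => (levelMean w m n).re) atTop (𝓝 (ψ n).re) := fun n =>
    (Complex.continuous_re.tendsto _).comp (hψ n)
  constructor
  · ext a b
    simp only [Matrix.conjTranspose_apply, toeplitz_apply, star_trivial]
    refine tendsto_nhds_unique (hre (b - a)) ((hre (a - b)).congr fun m => ?_)
    have : levelMean w m (b - a) = conj (levelMean w m (a - b)) := by
      simp only [levelMean, map_div₀, map_sum, map_zpow₀, map_pow, Complex.conj_ofNat]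
      congr 1
      refine Finset.sum_congr rfl fun i _ => ?_
      rw [← Circle.coe_inv_eq_conj, Circle.coe_inv, inv_zpow', neg_sub]
    rw [this, Complex.conj_re]
  · intro x
    refine ge_of_tendsto' (f := fun m => x.sum fun a s => x.sum fun b t =>
      star s * (levelMean w m (a - b)).re * t) (x := atTop) ?_ fun m => ?_
    · exact tendsto_finsetSum _ fun a _ => tendsto_finsetSum _ fun b _ =>
        ((hre _).const_mul _).mul_const _
    · have h : ∀ i, ((‖∑ a ∈ x.support, (x a : ℂ) * (w i : ℂ) ^ a‖ ^ 2 : ℝ) : ℂ) =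
          ∑ a ∈ x.support, ∑ b ∈ x.support, (x a : ℂ) * x b * (w i : ℂ) ^ (a - b) := by
        intro i
        rw [Complex.ofReal_pow, ← Complex.mul_conj', map_sum, Finset.sum_mul_sum]
        refine Finset.sum_congr rfl fun a _ => Finset.sum_congr rfl fun b _ => ?_
        rw [map_mul, Complex.conj_ofReal, map_zpow₀, ← Circle.coe_inv_eq_conj, Circle.coe_inv,
          inv_zpow, zpow_sub₀ (w i).coe_ne_zero]
        field_simp
      have h2 : (x.sum fun a s => x.sum fun b t => star s * (levelMean w m (a - b)).re * t) =
          (∑ i ∈ Finset.range (2 ^ m), ‖∑ a ∈ x.support, (x a : ℂ) * (w i : ℂ) ^ a‖ ^ 2) /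
            2 ^ m := by
        have h3 : (((∑ i ∈ Finset.range (2 ^ m),
            ‖∑ a ∈ x.support, (x a : ℂ) * (w i : ℂ) ^ a‖ ^ 2) / 2 ^ m : ℝ) : ℂ) =
            ∑ a ∈ x.support, ∑ b ∈ x.support, (x a * x b : ℝ) * levelMean w m (a - b) := by
          rw [Complex.ofReal_div, Complex.ofReal_sum]
          simp_rw [h]
          rw [Finset.sum_comm, Finset.sum_div]
          refine Finset.sum_congr rfl fun a _ => ?_
          rw [Finset.sum_comm, Finset.sum_div]
          refine Finset.sum_congr rfl fun b _ => ?_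
          rw [levelMean, ← Finset.mul_sum]
          push_cast
          ring
        have h4 := congrArg Complex.re h3
        rw [Complex.ofReal_re] at h4
        rw [h4]
        simp only [Complex.re_sum, Complex.re_ofReal_mul, Finsupp.sum, star_trivial]
        exact Finset.sum_congr rfl fun a _ => Finset.sum_congr rfl fun b _ => by ring
      rw [h2]
      positivity

/-- A point of the tree is much closer to its ancestor at level `m` than any two points at level `m`
are to each other. -/
theorem IsTree.norm_sub_ancestor_le {w : ℕ → Circle} (hw : IsTree w) {m a b : ℕ}
    (ha : a < 2 ^ m) (hb : b < 2 ^ m) (hab : a ≠ b) (j : ℕ) :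
    ‖(w j : ℂ) - w (j % 2 ^ m)‖ ≤ ‖(w a : ℂ) - w b‖ / 4 := by
  set δ := ‖(w a : ℂ) - w b‖ / 4 with hδ
  have hδ0 : 0 ≤ δ := by positivity
  have key : ∀ M, m ≤ M → ∀ j < 2 ^ M,
      ‖(w j : ℂ) - w (j % 2 ^ m)‖ ≤ (1 - (1 / 2) ^ M) * δ := by
    intro M hM
    induction M, hM using Nat.le_induction with
    | base =>
      intro j hj
      rw [Nat.mod_eq_of_lt hj, sub_self, norm_zero]
      have : (1 / 2 : ℝ) ^ m ≤ 1 := pow_le_one₀ (by norm_num) (by norm_num)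
      exact mul_nonneg (by linarith) hδ0
    | succ M hM ih =>
      intro j hj
      have hhalf : (1 / 2 : ℝ) ^ (M + 1) = (1 / 2) ^ M / 2 := by rw [pow_succ]; ring
      have hpos : (0 : ℝ) ≤ (1 / 2) ^ M := by positivity
      rcases lt_or_ge j (2 ^ M) with hj' | hj'
      · refine (ih j hj').trans (mul_le_mul_of_nonneg_right ?_ hδ0)
        linarith
      · obtain ⟨i, rfl⟩ := Nat.exists_eq_add_of_le' hj'
        have hi : i < 2 ^ M := by rw [pow_succ] at hj; omega
        have hmM : 2 ^ m ≤ 2 ^ M := Nat.pow_le_pow_right (by norm_num) hM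
        have hmod : (i + 2 ^ M) % 2 ^ m = i % 2 ^ m := by
          obtain ⟨c, hc⟩ := pow_dvd_pow 2 hM
          rw [hc, Nat.add_mul_mod_self_left]
        have h1 := hw.sep M i hi a b (by omega) (by omega) hab
        rw [← hδ] at h1
        have h2 := ih i hi
        rw [hmod]
        have h3 := norm_sub_le_norm_sub_add_norm_sub (w (i + 2 ^ M) : ℂ) (w i) (w (i % 2 ^ m))
        rw [hhalf] at h1 ⊢
        nlinarith
  have hj : j < 2 ^ (m + j) := (Nat.lt_two_pow_self).trans_le
    (Nat.pow_le_pow_right (by norm_num) (by omega))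
  refine (key (m + j) (by omega) j hj).trans ?_
  have : (0 : ℝ) ≤ (1 / 2) ^ (m + j) := by positivity
  nlinarith

theorem card_filter_mod_eq {m M : ℕ} (h : m ≤ M) (r : ℕ) :
    ((Finset.range (2 ^ M)).filter fun j => j % 2 ^ m = r % 2 ^ m).card = 2 ^ (M - m) := by
  have := Nat.count_modEq_card (2 ^ M) (r := 2 ^ m) (by positivity) r
  rw [Nat.count_eq_card_filter_range, Nat.mod_eq_zero_of_dvd (pow_dvd_pow 2 h),
    if_neg (by omega), add_zero, Nat.pow_div h (by norm_num)] at this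
  exact this

/-- The points at level `m` carry equal masses in the measures at the higher levels, so the Fejér
means of the squared Fourier coefficients of the latter are about `2 ^ (-m)` at most. -/
theorem IsTree.sum_norm_sq_levelMean_le {w : ℕ → Circle} (hw : IsTree w) (m : ℕ) :
    ∃ C : ℝ, ∀ M, m ≤ M → ∀ N : ℕ, ∑ a ∈ Finset.range N, ∑ b ∈ Finset.range N,
      ‖levelMean w M ((a : ℤ) - b)‖ ^ 2 ≤ (1 / 2) ^ m * (N : ℝ) ^ 2 + C := by
  obtain ⟨δ, hδ, hsep⟩ : ∃ δ > 0, ∀ i j, i % 2 ^ m ≠ j % 2 ^ m →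
      δ ≤ ‖(w i : ℂ) - w j‖ := by
    rcases Finset.eq_empty_or_nonempty ((Finset.range (2 ^ m)).offDiag) with he | hne
    · refine ⟨1, one_pos, fun i j hij => ?_⟩
      have : (i % 2 ^ m, j % 2 ^ m) ∈ (Finset.range (2 ^ m)).offDiag := by
        simp [Finset.mem_offDiag, hij, Nat.mod_lt]
      rw [he] at this
      simp at this
    · obtain ⟨⟨a, b⟩, hab, hmin⟩ := Finset.exists_min_image _
        (fun p : ℕ × ℕ => ‖(w p.1 : ℂ) - w p.2‖) hne
      simp only [Finset.mem_offDiag, Finset.mem_range] at hab hmin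
      have hpos : 0 < ‖(w a : ℂ) - w b‖ := norm_pos_iff.2 (sub_ne_zero.2 fun h =>
        hab.2.2 (hw.injective (Circle.coe_injective h)))
      refine ⟨‖(w a : ℂ) - w b‖ / 2, by positivity, fun i j hij => ?_⟩
      have h1 := hmin (i % 2 ^ m, j % 2 ^ m)
        ⟨Nat.mod_lt _ (by positivity), Nat.mod_lt _ (by positivity), hij⟩
      have h2 := hw.norm_sub_ancestor_le hab.1 hab.2.1 hab.2.2 i
      have h3 := hw.norm_sub_ancestor_le hab.1 hab.2.1 hab.2.2 j
      have h4 : ‖(w (i % 2 ^ m) : ℂ) - w (j % 2 ^ m)‖ ≤ ‖(w i : ℂ) - w (i % 2 ^ m)‖ +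
          ‖(w i : ℂ) - w j‖ + ‖(w j : ℂ) - w (j % 2 ^ m)‖ := by
        have : (w (i % 2 ^ m) : ℂ) - w (j % 2 ^ m) = -((w i : ℂ) - w (i % 2 ^ m)) +
          ((w i : ℂ) - w j) + ((w j : ℂ) - w (j % 2 ^ m)) := by ring
        rw [this]
        refine (norm_add₃_le).trans ?_
        rw [norm_neg]
      simp only at h1
      linarith
  refine ⟨(2 / δ) ^ 2, fun M hM N => ?_⟩
  -- The sum over `a` and `b` is the average of `‖D (u / v)‖ ^ 2` over the points `u`, `v` at level `M`.
  -- It is at most `N ^ 2`, and bounded if `u`, `v` have different ancestors at level `m`.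
  set D : Circle → ℂ := fun u => ∑ a ∈ Finset.range N, (u : ℂ) ^ a with hD
  have hcoe : ∀ i j (k : ℤ), ((w i * (w j)⁻¹ : Circle) : ℂ) ^ k = (w i : ℂ) ^ k * conj ((w j : ℂ) ^ k) := by
    intro i j k
    rw [Circle.coe_mul, mul_zpow, map_zpow₀, ← Circle.coe_inv_eq_conj]
  have hDsq : ∀ u : Circle, ((‖D u‖ ^ 2 : ℝ) : ℂ) =
      ∑ a ∈ Finset.range N, ∑ b ∈ Finset.range N, (u : ℂ) ^ ((a : ℤ) - b) := by
    intro u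
    rw [Complex.ofReal_pow, ← Complex.mul_conj', map_sum, Finset.sum_mul_sum]
    refine Finset.sum_congr rfl fun a _ => Finset.sum_congr rfl fun b _ => ?_
    rw [map_pow, ← Circle.coe_inv_eq_conj, zpow_sub₀ u.coe_ne_zero, zpow_natCast, zpow_natCast,
      Circle.coe_inv, inv_pow]
    rfl
  have hmain : (4 : ℝ) ^ M * ∑ a ∈ Finset.range N, ∑ b ∈ Finset.range N,
      ‖levelMean w M ((a : ℤ) - b)‖ ^ 2 =
      ∑ i ∈ Finset.range (2 ^ M), ∑ j ∈ Finset.range (2 ^ M), ‖D (w i * (w j)⁻¹)‖ ^ 2 := by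
    have hpow : (4 : ℂ) ^ M = 2 ^ M * 2 ^ M := by rw [← mul_pow]; norm_num
    have hlev : ∀ k : ℤ, (4 : ℂ) ^ M * ((‖levelMean w M k‖ ^ 2 : ℝ) : ℂ) =
        ∑ i ∈ Finset.range (2 ^ M), ∑ j ∈ Finset.range (2 ^ M),
          ((w i * (w j)⁻¹ : Circle) : ℂ) ^ k := by
      intro k
      simp_rw [hcoe]
      rw [← Finset.sum_mul_sum, ← map_sum, Complex.ofReal_pow, ← Complex.mul_conj', levelMean,
        map_div₀, hpow, map_pow, Complex.conj_ofNat]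
      field_simp
    have : ((4 : ℝ) ^ M * ∑ a ∈ Finset.range N, ∑ b ∈ Finset.range N,
        ‖levelMean w M ((a : ℤ) - b)‖ ^ 2 : ℂ) =
        ((∑ i ∈ Finset.range (2 ^ M), ∑ j ∈ Finset.range (2 ^ M), ‖D (w i * (w j)⁻¹)‖ ^ 2 : ℝ) : ℂ) := by
      push_cast
      have h1 : ∀ u : Circle, (‖D u‖ : ℂ) ^ 2 = ((‖D u‖ ^ 2 : ℝ) : ℂ) := fun u => by push_cast; rfl
      have h2 : ∀ k : ℤ, (‖levelMean w M k‖ : ℂ) ^ 2 = ((‖levelMean w M k‖ ^ 2 : ℝ) : ℂ) :=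
        fun u => by push_cast; rfl
      simp_rw [h1, h2, hDsq, Finset.mul_sum, hlev]
      simp_rw [Finset.sum_comm (s := Finset.range N) (t := Finset.range (2 ^ M))]
    exact_mod_cast this
  have hDN : ∀ u, ‖D u‖ ≤ N := fun u => by
    refine (norm_sum_le _ _).trans ?_
    simp [Circle.norm_coe]
  have hterm : ∀ i j, ‖D (w i * (w j)⁻¹)‖ ^ 2 ≤
      (if j % 2 ^ m = i % 2 ^ m then (N : ℝ) ^ 2 else 0) + (2 / δ) ^ 2 := by
    intro i j
    split_ifs with hij
    · have := hDN (w i * (w j)⁻¹)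
      have h2 : ‖D (w i * (w j)⁻¹)‖ ^ 2 ≤ (N : ℝ) ^ 2 := by gcongr
      have : 0 ≤ (2 / δ) ^ 2 := by positivity
      linarith
    · rw [zero_add]
      gcongr
      rw [le_div_iff₀ hδ]
      refine le_trans ?_ (Circle.norm_geom_sum_le (w i * (w j)⁻¹) N)
      gcongr
      refine (hsep i j (Ne.symm hij)).trans (le_of_eq ?_)
      have : (w i : ℂ) - w j = (((w i * (w j)⁻¹ : Circle) : ℂ) - 1) * w j := by
        rw [Circle.coe_mul, Circle.coe_inv]
        field_simp [(w j).coe_ne_zero]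
      rw [this, norm_mul, Circle.norm_coe, mul_one]
  have hsum : ∑ i ∈ Finset.range (2 ^ M), ∑ j ∈ Finset.range (2 ^ M), ‖D (w i * (w j)⁻¹)‖ ^ 2 ≤
      (4 : ℝ) ^ M * ((1 / 2) ^ m * (N : ℝ) ^ 2 + (2 / δ) ^ 2) := by
    calc _ ≤ ∑ i ∈ Finset.range (2 ^ M), ∑ j ∈ Finset.range (2 ^ M),
          ((if j % 2 ^ m = i % 2 ^ m then (N : ℝ) ^ 2 else 0) + (2 / δ) ^ 2) :=
          Finset.sum_le_sum fun i _ => Finset.sum_le_sum fun j _ => hterm i j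
      _ = _ := by
        simp_rw [Finset.sum_add_distrib, ← Finset.sum_filter, Finset.sum_const,
          card_filter_mod_eq hM, Finset.sum_const, Finset.card_range, nsmul_eq_mul]
        have h4 : (4 : ℝ) ^ M = 2 ^ M * 2 ^ M := by rw [← mul_pow]; norm_num
        have h5 : (2 : ℝ) ^ M = 2 ^ m * 2 ^ (M - m) := by rw [← pow_add]; congr 1; omega
        push_cast
        rw [h4, one_div, inv_pow, mul_add]
        congr 1
        · nth_rewrite 3 [h5]
          field_simp
        · ring
  rw [← hmain] at hsum
  exact le_of_mul_le_mul_left hsum (by positivity)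

/-- The limit measure of a tree is continuous, in the quantitative form needed here. -/
theorem IsTree.isCesaroNull {w : ℕ → Circle} (hw : IsTree w) {ψ : ℤ → ℂ}
    (hψ : ∀ n, Tendsto (fun m => levelMean w m n) atTop (𝓝 (ψ n))) : IsCesaroNull ψ := by
  refine tendsto_order.2 ⟨fun a ha => .of_forall fun N => ha.trans_le (fejerMean_nonneg ψ N),
    fun ε hε => ?_⟩
  obtain ⟨m, hm⟩ := exists_pow_lt_of_lt_one (show (0 : ℝ) < ε ^ 2 / 4 by positivity)
    (show (1 / 2 : ℝ) < 1 by norm_num)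
  obtain ⟨C, hC⟩ := hw.sum_norm_sq_levelMean_le m
  have hsq : ∀ N : ℕ, ∑ a ∈ Finset.range N, ∑ b ∈ Finset.range N, ‖ψ ((a : ℤ) - b)‖ ^ 2 ≤
      (1 / 2) ^ m * (N : ℝ) ^ 2 + C := fun N =>
    le_of_tendsto (tendsto_finsetSum _ fun a _ => tendsto_finsetSum _ fun b _ =>
      ((hψ _).norm.pow 2)) ((eventually_ge_atTop m).mono fun M hM => hC M hM N)
  have hlim : Tendsto (fun N : ℕ => C / (N : ℝ) ^ 2) atTop (𝓝 0) :=
    tendsto_const_nhds.div_atTop (tendsto_pow_atTop two_ne_zero |>.comp tendsto_natCast_atTop_atTop)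
  filter_upwards [(tendsto_order.1 hlim).2 (ε ^ 2 / 4) (by positivity), eventually_gt_atTop 0]
    with N hN hN0
  have hN0' : (0 : ℝ) < N := by exact_mod_cast hN0
  rw [div_lt_iff₀ (by positivity)] at hN
  -- `x ≤ ε / 2 + x ^ 2 / (2 * ε)`
  have hle : ∀ x : ℝ, x ≤ ε / 2 + x ^ 2 / (2 * ε) := fun x => by
    have : ε / 2 + x ^ 2 / (2 * ε) - x = (x - ε) ^ 2 / (2 * ε) := by field_simp; ring
    have h2 : 0 ≤ (x - ε) ^ 2 / (2 * ε) := by positivity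
    linarith
  rw [fejerMean, div_lt_iff₀ (by positivity)]
  calc _ ≤ ∑ a ∈ Finset.range N, ∑ b ∈ Finset.range N,
        (ε / 2 + ‖ψ ((a : ℤ) - b)‖ ^ 2 / (2 * ε)) :=
        Finset.sum_le_sum fun a _ => Finset.sum_le_sum fun b _ => hle _
    _ = ε / 2 * (N : ℝ) ^ 2 + (∑ a ∈ Finset.range N, ∑ b ∈ Finset.range N,
        ‖ψ ((a : ℤ) - b)‖ ^ 2) / (2 * ε) := by
        simp only [Finset.sum_add_distrib, Finset.sum_const, Finset.card_range, nsmul_eq_mul,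
          Finset.sum_div]
        ring
    _ ≤ ε / 2 * (N : ℝ) ^ 2 + ((1 / 2) ^ m * (N : ℝ) ^ 2 + C) / (2 * ε) := by
        gcongr
        exact hsq N
    _ < ε / 2 * (N : ℝ) ^ 2 + (ε ^ 2 / 4 * (N : ℝ) ^ 2 + ε ^ 2 / 4 * (N : ℝ) ^ 2) / (2 * ε) := by
        gcongr
    _ = 3 / 4 * ε * (N : ℝ) ^ 2 := by field_simp; ring
    _ ≤ ε * (N : ℝ) ^ 2 := by
        have : 0 < ε * (N : ℝ) ^ 2 := by positivity
        linarith

/-- The mean of `|z ^ n - 1|` over the points `z` at level `M` is small if all but one of the points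
of index at most `s` have `z ^ n` near `1`, and the later points follow their parents. -/
theorem sum_norm_zpow_sub_one_le {w : ℕ → Circle} {n : ℤ} {s i₀ : ℕ} {ε : ℝ} (hε : 0 ≤ ε)
    (hgood : ∀ i ≤ s, i ≠ i₀ → ‖(w i : ℂ) ^ n - 1‖ ≤ ε)
    (hclose : ∀ m i, i < 2 ^ m → s < i + 2 ^ m →
      ‖(w (i + 2 ^ m) : ℂ) ^ n - (w i : ℂ) ^ n‖ ≤ (1 / 2) ^ (m + 1)) {M : ℕ}
    (hM : Nat.log 2 (s + 1) + 1 ≤ M) :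
    (∑ i ∈ Finset.range (2 ^ M), ‖(w i : ℂ) ^ n - 1‖) / 2 ^ M ≤ ε + 6 / (s + 1) := by
  set m := Nat.log 2 (s + 1) with hm
  have hm1 : 2 ^ m ≤ s + 1 := Nat.pow_log_le_self 2 (by omega)
  have hm2 : s + 1 < 2 ^ (m + 1) := Nat.lt_pow_succ_log_self (by norm_num) _
  set E : ℕ → ℝ := fun M => (∑ i ∈ Finset.range (2 ^ M), ‖(w i : ℂ) ^ n - 1‖) / 2 ^ M with hE
  have htwo : ∀ i, ‖(w i : ℂ) ^ n - 1‖ ≤ 2 := fun i => by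
    refine (norm_sub_le _ _).trans ?_
    rw [Circle.norm_coe_zpow, norm_one]; norm_num
  -- At level `m + 1` only `i₀` and its descendant `i₀ + 2 ^ m` can be exceptional.
  have hbase : E (m + 1) ≤ ε + 5 * (1 / 2) ^ (m + 1) := by
    have hterm : ∀ i ∈ Finset.range (2 ^ (m + 1)), ‖(w i : ℂ) ^ n - 1‖ ≤
        ε + (1 / 2) ^ (m + 1) + ((if i = i₀ then 2 else 0) + if i = i₀ + 2 ^ m then 2 else 0) := by
      intro i hi
      rw [Finset.mem_range] at hi
      have h0 : (0 : ℝ) ≤ (1 / 2) ^ (m + 1) := by positivity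
      by_cases h1 : i = i₀
      · have := htwo i
        rw [if_pos h1]
        split_ifs <;> linarith
      by_cases h2 : i = i₀ + 2 ^ m
      · have := htwo i
        rw [if_neg h1, if_pos h2]
        linarith
      rw [if_neg h1, if_neg h2]
      rcases le_or_gt i s with his | his
      · have := hgood i his h1
        linarith
      · obtain ⟨j, rfl⟩ := Nat.exists_eq_add_of_le' (show 2 ^ m ≤ i by omega)
        rw [pow_succ] at hi
        have h3 := hclose m j (by omega) his
        have h4 := hgood j (by omega) (by omega)
        have h5 := norm_sub_le_norm_sub_add_norm_sub ((w (j + 2 ^ m) : ℂ) ^ n) ((w j : ℂ) ^ n) 1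
        linarith
    have hsum : ∑ i ∈ Finset.range (2 ^ (m + 1)), ‖(w i : ℂ) ^ n - 1‖ ≤
        2 ^ (m + 1) * (ε + (1 / 2) ^ (m + 1)) + 4 := by
      refine (Finset.sum_le_sum hterm).trans ?_
      rw [Finset.sum_add_distrib, Finset.sum_add_distrib, Finset.sum_add_distrib]
      have h1 : ∀ c : ℕ, ∑ i ∈ Finset.range (2 ^ (m + 1)), (if i = c then (2 : ℝ) else 0) ≤ 2 := by
        intro c
        rw [Finset.sum_ite_eq']
        split_ifs <;> norm_num
      have := h1 i₀
      have := h1 (i₀ + 2 ^ m)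
      simp only [Finset.sum_const, Finset.card_range, nsmul_eq_mul]
      push_cast
      linarith
    rw [hE]
    simp only
    rw [div_le_iff₀ (by positivity)]
    have : (1 / 2 : ℝ) ^ (m + 1) * 2 ^ (m + 1) = 1 := by rw [← mul_pow]; norm_num
    nlinarith
  have hstep : ∀ M, m + 1 ≤ M → E (M + 1) ≤ E M + (1 / 2) ^ (M + 1) := by
    intro M hM
    have hMs : s < 2 ^ M := by
      have : 2 ^ (m + 1) ≤ 2 ^ M := Nat.pow_le_pow_right (by norm_num) hM
      omega
    simp only [hE]
    rw [sum_range_two_pow_succ]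
    have h1 : ∑ i ∈ Finset.range (2 ^ M), ‖(w (i + 2 ^ M) : ℂ) ^ n - 1‖ ≤
        ∑ i ∈ Finset.range (2 ^ M), (‖(w i : ℂ) ^ n - 1‖ + (1 / 2) ^ (M + 1)) := by
      refine Finset.sum_le_sum fun i hi => ?_
      have h3 := hclose M i (Finset.mem_range.1 hi) (by omega)
      have h5 := norm_sub_le_norm_sub_add_norm_sub ((w (i + 2 ^ M) : ℂ) ^ n) ((w i : ℂ) ^ n) 1
      linarith
    simp only [Finset.sum_add_distrib, Finset.sum_const, Finset.card_range, nsmul_eq_mul] at h1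
    push_cast at h1
    rw [div_add' _ _ _ (by positivity), div_le_div_iff₀ (by positivity) (by positivity)]
    have h6 : (1 / 2 : ℝ) ^ (M + 1) * 2 ^ (M + 1) = 1 := by rw [← mul_pow]; norm_num
    have h7 : (2 : ℝ) ^ (M + 1) = 2 * 2 ^ M := by ring
    have h8 : (0 : ℝ) < 2 ^ M := by positivity
    have h9 : (1 / 2 : ℝ) ^ (M + 1) * 2 ^ M = 1 / 2 := by rw [h7] at h6; linarith
    rw [mul_comm ((2 : ℝ) ^ M), h9] at h1
    rw [h9, h7]
    nlinarith
  have hall : ∀ M, m + 1 ≤ M → E M ≤ ε + 6 * (1 / 2) ^ (m + 1) - (1 / 2) ^ M := by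
    intro M hM
    induction M, hM using Nat.le_induction with
    | base => linarith
    | succ M hM ih =>
      have := hstep M hM
      have h2 : (1 / 2 : ℝ) ^ M = 2 * (1 / 2) ^ (M + 1) := by rw [pow_succ]; ring
      linarith
  refine (hall M hM).trans ?_
  have h1 : (0 : ℝ) ≤ (1 / 2) ^ M := by positivity
  have h2 : (1 / 2 : ℝ) ^ (m + 1) ≤ 1 / (s + 1) := by
    rw [one_div, inv_pow, ← one_div]
    apply one_div_le_one_div_of_le (by positivity)
    exact_mod_cast hm2.le
  have h3 : (6 : ℝ) / (s + 1) = 6 * (1 / (s + 1)) := by ring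
  linarith

/-- A sequence of integers is a rigidity sequence as soon as there is a tree of points `z` such that
for the `k`-th term `n k` all but one of the first points, up to an index `s k` that tends to
infinity, have `z ^ n k` near `1`, while the later ones follow their parents. -/
theorem IsTree.isRigiditySequence {w : ℕ → Circle} (hw : IsTree w) {n : ℕ → ℤ} {s : ℕ → ℕ}
    (hs : Tendsto s atTop atTop) {ε : ℕ → ℝ} (hε : Tendsto ε atTop (𝓝 0)) (hε0 : ∀ j, 0 ≤ ε j)
    (hgood : ∀ k, ∃ i₀, ∀ i ≤ s k, i ≠ i₀ → ‖(w i : ℂ) ^ n k - 1‖ ≤ ε (s k))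
    (hclose : ∀ k m i, i < 2 ^ m → s k < i + 2 ^ m →
      ‖(w (i + 2 ^ m) : ℂ) ^ n k - (w i : ℂ) ^ n k‖ ≤ (1 / 2) ^ (m + 1)) :
    IsRigiditySequence n := by
  obtain ⟨ψ, hψ⟩ := hw.exists_tendsto_levelMean
  have hψ1 : ∀ n, ‖ψ n‖ ≤ 1 := fun n =>
    le_of_tendsto (hψ n).norm (.of_forall fun m => norm_levelMean_le w m n)
  have hdiff : ∀ k t, ‖ψ (n k + t) - ψ t‖ ≤ ε (s k) + 6 / ((s k : ℝ) + 1) := by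
    intro k t
    refine le_of_tendsto ((hψ (n k + t)).sub (hψ t)).norm ?_
    obtain ⟨i₀, hi₀⟩ := hgood k
    filter_upwards [eventually_ge_atTop (Nat.log 2 (s k + 1) + 1)] with M hM
    refine le_trans ?_ (sum_norm_zpow_sub_one_le (hε0 _) hi₀ (hclose k) hM)
    rw [levelMean, levelMean, ← sub_div, ← Finset.sum_sub_distrib, norm_div, norm_pow,
      Complex.norm_ofNat]
    gcongr
    refine (norm_sum_le _ _).trans (Finset.sum_le_sum fun i _ => le_of_eq ?_)
    rw [zpow_add₀ (w i).coe_ne_zero, ← sub_one_mul, norm_mul, Circle.norm_coe_zpow, mul_one]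
  have hlim : Tendsto (fun k => ε (s k) + 6 / ((s k : ℝ) + 1)) atTop (𝓝 0) := by
    have h1 : Tendsto (fun j : ℕ => ε j + 6 / ((j : ℝ) + 1)) atTop (𝓝 (0 + 0)) :=
      hε.add (tendsto_const_nhds.div_atTop
        (tendsto_atTop_add_const_right _ _ tendsto_natCast_atTop_atTop))
    rw [add_zero] at h1
    exact h1.comp hs
  refine isRigiditySequence_of_posSemidef (φ := fun n => (ψ n).re)
    (posSemidef_toeplitz_of_tendsto hψ) ?_ (fun n => (Complex.abs_re_le_norm _).trans (hψ1 n))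
    ((hw.isCesaroNull hψ).mono fun n => Complex.abs_re_le_norm _) fun t => ?_
  · have h0 : ψ 0 = 1 := by
      refine tendsto_nhds_unique (hψ 0) (tendsto_const_nhds.congr fun m => ?_)
      simp [levelMean]
    simp [h0]
  · refine (Complex.continuous_re.tendsto _).comp ?_
    rw [tendsto_iff_norm_sub_tendsto_zero]
    exact squeeze_zero (fun k => norm_nonneg _) (fun k => hdiff k t) hlim

end Tree

/-! ### Construction of trees, and sequences with infinite limit group -/

section Construction

theorem Circle.dist_eq (x y : Circle) : dist x y = ‖(x : ℂ) - y‖ := dist_eq_norm (x : ℂ) y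

/-- A sequence built by dependent choices: each term satisfies the relation `R j` with the earlier
terms if this is possible. -/
noncomputable def dependentSeq {α : Type*} [Nonempty α] (R : ∀ j : ℕ, (Fin j → α) → α → Prop)
    (j : ℕ) : α :=
  open Classical in
  if h : ∃ x, R j (fun i : Fin j => dependentSeq R i) x then h.choose else Classical.arbitrary α
termination_by j
decreasing_by all_goals exact Fin.is_lt _

theorem exists_dependentSeq {α : Type*} [Nonempty α] (R : ∀ j : ℕ, (Fin j → α) → α → Prop)
    (h : ∀ (j : ℕ) (f : Fin j → α),
      (∀ i : Fin j, R i (fun l : Fin i => f ⟨l, l.2.trans i.2⟩) (f i)) → ∃ x, R j f x) :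
    ∃ w : ℕ → α, ∀ j, R j (fun i : Fin j => w i) (w j) := by
  refine ⟨dependentSeq R, fun j => ?_⟩
  induction j using Nat.strong_induction_on with
  | _ j ih =>
    have hex := h j (fun i => dependentSeq R i) fun i => ih i i.2
    rw [dependentSeq, dif_pos hex]
    exact hex.choose_spec

/-- Trees can be built point by point inside sets of candidates `C j f`, which may depend on the
earlier points `f`, as soon as the candidates accumulate at the earlier points. Moreover, the powers
of a new point with exponents in a finite set `S j f` can be kept near those of its parent. -/
theorem exists_isTree (C : ∀ j : ℕ, (Fin j → Circle) → Set Circle)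
    (S : ∀ j : ℕ, (Fin j → Circle) → Finset ℤ) (h0 : ∀ f, (C 0 f).Nonempty)
    (hC : ∀ (j : ℕ) (f : Fin j → Circle),
      (∀ i : Fin j, f i ∈ C i fun l : Fin i => f ⟨l, l.2.trans i.2⟩) →
      ∀ i : Fin j, ∀ ε > 0, ∃ x ∈ C j f, x ≠ f i ∧ ‖(x : ℂ) - f i‖ < ε) :
    ∃ w : ℕ → Circle, IsTree w ∧ (∀ j, w j ∈ C j fun i : Fin j => w i) ∧
      ∀ m i, i < 2 ^ m → ∀ n ∈ S (i + 2 ^ m) (fun l => w l),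
        ‖(w (i + 2 ^ m) : ℂ) ^ n - (w i : ℂ) ^ n‖ ≤ (1 / 2) ^ (m + 1) := by
  -- The relation between a point and its predecessors.
  let R : ∀ j : ℕ, (Fin j → Circle) → Circle → Prop := fun j f x =>
    x ∈ C j f ∧ (∀ a, x ≠ f a) ∧ ∀ (m : ℕ) (i : Fin j), (i : ℕ) < 2 ^ m → j = i + 2 ^ m →
      ‖(x : ℂ) - f i‖ ≤ (1 / 2) ^ (m + 1) ∧
      (∀ a b, f a ≠ f b → ‖(x : ℂ) - f i‖ ≤ (1 / 2) ^ (m + 1) * (‖(f a : ℂ) - f b‖ / 4)) ∧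
      ∀ n ∈ S j f, ‖(x : ℂ) ^ n - (f i : ℂ) ^ n‖ ≤ (1 / 2) ^ (m + 1)
  obtain ⟨w, hw⟩ := exists_dependentSeq R (by
    intro j f hf
    rcases Nat.eq_zero_or_pos j with rfl | hj
    · obtain ⟨x, hx⟩ := h0 f
      exact ⟨x, hx, fun a => a.elim0, fun m i => i.elim0⟩
    -- The level `m₀` and the parent `i₀` of the new point.
    set m₀ := Nat.log 2 j with hm₀
    have hm1 : 2 ^ m₀ ≤ j := Nat.pow_log_le_self 2 hj.ne'
    have hm2 : j < 2 ^ (m₀ + 1) := Nat.lt_pow_succ_log_self (by norm_num) _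
    let i₀ : Fin j := ⟨j - 2 ^ m₀, by have := Nat.two_pow_pos m₀; omega⟩
    have hparent : ∀ (m : ℕ) (i : Fin j), (i : ℕ) < 2 ^ m → j = i + 2 ^ m → m = m₀ ∧ i = i₀ := by
      intro m i hi hij
      have h1 : m = m₀ := by
        rw [hm₀, eq_comm, Nat.log_eq_iff (Or.inr ⟨by norm_num, hj.ne'⟩), pow_succ]
        omega
      subst h1
      exact ⟨rfl, Fin.ext (by simp only [i₀]; omega)⟩
    have hev : ∀ᶠ x in 𝓝 (f i₀), ((∀ a, f a ≠ f i₀ → x ≠ f a) ∧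
        ‖(x : ℂ) - f i₀‖ ≤ (1 / 2) ^ (m₀ + 1) ∧
        (∀ a b, f a ≠ f b →
          ‖(x : ℂ) - f i₀‖ ≤ (1 / 2) ^ (m₀ + 1) * (‖(f a : ℂ) - f b‖ / 4)) ∧
        ∀ n ∈ S j f, ‖(x : ℂ) ^ n - (f i₀ : ℂ) ^ n‖ ≤ (1 / 2) ^ (m₀ + 1)) := by
      have hdist : Tendsto (fun x : Circle => ‖(x : ℂ) - f i₀‖) (𝓝 (f i₀)) (𝓝 0) := by
        have : Continuous fun x : Circle => ‖(x : ℂ) - f i₀‖ := by fun_prop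
        simpa using this.tendsto (f i₀)
      have hdistpow : ∀ n : ℤ, Tendsto (fun x : Circle => ‖(x : ℂ) ^ n - (f i₀ : ℂ) ^ n‖)
          (𝓝 (f i₀)) (𝓝 0) := by
        intro n
        have h1 : Continuous fun x : Circle => ((x ^ n : Circle) : ℂ) :=
          continuous_subtype_val.comp (continuous_zpow n)
        have h2 : Continuous fun x : Circle => ‖((x ^ n : Circle) : ℂ) - (f i₀ : ℂ) ^ n‖ := by
          fun_prop
        simpa using h2.tendsto (f i₀)
      refine .and (eventually_all.2 fun a => ?_) (.and ?_ (.and (eventually_all.2 fun a =>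
        eventually_all.2 fun b => ?_) ((Finset.eventually_all _).2 fun n hn => ?_)))
      · by_cases h : f a = f i₀
        · exact .of_forall fun x hx => absurd h hx
        · filter_upwards [eventually_ne_nhds (Ne.symm h)] with x hx _ using hx
      · exact hdist.eventually (eventually_le_nhds (by positivity))
      · by_cases h : f a = f b
        · exact .of_forall fun x hx => absurd h hx
        · have : 0 < ‖(f a : ℂ) - f b‖ := norm_pos_iff.2 (sub_ne_zero.2 fun h' =>
            h (Circle.coe_injective h'))
          filter_upwards [hdist.eventually (eventually_le_nhds
            (show 0 < (1 / 2 : ℝ) ^ (m₀ + 1) * (‖(f a : ℂ) - f b‖ / 4) by positivity))]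
            with x hx _ using hx
      · exact (hdistpow n).eventually (eventually_le_nhds (by positivity))
    obtain ⟨ε, hε, hball⟩ := Metric.eventually_nhds_iff.1 hev
    obtain ⟨x, hxC, hxne, hx⟩ := hC j f (fun i => (hf i).1) i₀ ε hε
    obtain ⟨h1, h2, h3, h4⟩ := hball (show dist x (f i₀) < ε by
      rwa [Circle.dist_eq])
    refine ⟨x, hxC, fun a => ?_, ?_⟩
    · by_cases h : f a = f i₀
      · rwa [h]
      · exact h1 a h
    · intro m i hi hij
      obtain ⟨rfl, rfl⟩ := hparent m i hi hij
      exact ⟨h2, h3, h4⟩)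
  have hinj : Function.Injective w := by
    intro a b hab
    by_contra hne
    rcases lt_or_gt_of_ne hne with h | h
    · exact (hw b).2.1 ⟨a, h⟩ hab.symm
    · exact (hw a).2.1 ⟨b, h⟩ hab
  have hpos : ∀ i m : ℕ, i < i + 2 ^ m := fun i m => by have := Nat.two_pow_pos m; omega
  refine ⟨w, ⟨hinj, fun m i hi => ?_, fun m i hi a b ha hb hab => ?_⟩, fun j => (hw j).1,
    fun m i hi => ?_⟩
  · exact ((hw (i + 2 ^ m)).2.2 m ⟨i, hpos i m⟩ hi rfl).1
  · exact ((hw (i + 2 ^ m)).2.2 m ⟨i, hpos i m⟩ hi rfl).2.1 ⟨a, ha⟩ ⟨b, hb⟩ fun h => hab (hinj h)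
  · exact ((hw (i + 2 ^ m)).2.2 m ⟨i, hpos i m⟩ hi rfl).2.2

end Construction

section InfiniteGroup

/-- The points `z` of the circle with `z ^ n k → 1`. -/
def limitGroup (n : ℕ → ℤ) : Subgroup Circle where
  carrier := {z | Tendsto (fun k => z ^ n k) atTop (𝓝 1)}
  one_mem' := by simp
  mul_mem' {a b} ha hb := by
    simpa [mul_zpow] using Tendsto.mul ha hb
  inv_mem' {a} ha := by
    simpa using Tendsto.inv ha

/-- An infinite limit group has no isolated points: it contains distinct points arbitrarily close to each
other, whose quotients can be used as small translations. -/
theorem exists_mem_limitGroup_near {n : ℕ → ℤ} (hn : (limitGroup n : Set Circle).Infinite)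
    {x : Circle} (hx : x ∈ limitGroup n) {ε : ℝ} (hε : 0 < ε) :
    ∃ y ∈ limitGroup n, y ≠ x ∧ ‖(y : ℂ) - x‖ < ε := by
  obtain ⟨p, -, hp⟩ := hn.exists_accPt_of_subset_isCompact isCompact_univ (Set.subset_univ _)
  obtain ⟨b, hbD, hb⟩ : ∃ b ∈ limitGroup n, dist b p < ε / 2 := by
    obtain ⟨b, ⟨h1, h2⟩, -⟩ := accPt_iff_nhds.1 hp _ (Metric.ball_mem_nhds p (half_pos hε))
    exact ⟨b, h2, h1⟩
  obtain ⟨c, hcD, hc, hcb⟩ : ∃ c ∈ limitGroup n, dist c p < ε / 2 ∧ c ≠ b := by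
    by_cases hbp : b = p
    · obtain ⟨c, ⟨h1, h2⟩, h3⟩ := accPt_iff_nhds.1 hp _ (Metric.ball_mem_nhds p (half_pos hε))
      exact ⟨c, h2, h1, hbp ▸ h3⟩
    · obtain ⟨c, ⟨⟨h1, h1'⟩, h2⟩, h3⟩ := accPt_iff_nhds.1 hp _
        (Filter.inter_mem (Metric.ball_mem_nhds p (half_pos hε)) (isOpen_ne.mem_nhds (Ne.symm hbp)))
      exact ⟨c, h2, h1, h1'⟩
  refine ⟨x * (c * b⁻¹), mul_mem hx (mul_mem hcD (inv_mem hbD)), ?_, ?_⟩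
  · intro h
    have : c * b⁻¹ = 1 := by simpa using h
    exact hcb (mul_inv_eq_one.1 this)
  · have h1 : ((x * (c * b⁻¹) : Circle) : ℂ) - x = x * ((c : ℂ) - b) * ((b⁻¹ : Circle) : ℂ) := by
      have := b.coe_ne_zero
      rw [Circle.coe_mul, Circle.coe_mul, Circle.coe_inv]
      field_simp
    rw [h1, norm_mul, norm_mul, Circle.norm_coe, Circle.norm_coe, one_mul, mul_one, ← Circle.dist_eq]
    have := dist_triangle_right c b p
    linarith

/-- The tree is built inside the limit group. A new point follows its parent for all the terms `n k`
that come before the time at which the powers of the earlier points are near `1`. -/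
theorem isRigiditySequence_of_infinite_limitGroup {n : ℕ → ℤ}
    (hn : (limitGroup n : Set Circle).Infinite) : IsRigiditySequence n := by
  -- `K j f` is a time from which on the powers of the points `f i` are `1 / j`-near `1`.
  have hK : ∀ (j : ℕ) (f : Fin j → Circle), ∃ K, j ≤ K ∧ ((∀ i, f i ∈ limitGroup n) →
      ∀ k, K ≤ k → ∀ i, ‖(f i : ℂ) ^ n k - 1‖ ≤ 1 / j) := by
    intro j f
    by_cases hf : ∀ i, f i ∈ limitGroup n
    · have hev : ∀ᶠ k in atTop, ∀ i, ‖(f i : ℂ) ^ n k - 1‖ ≤ 1 / j := by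
        refine eventually_all.2 fun i => ?_
        have h1 : Tendsto (fun k => ‖((f i ^ n k : Circle) : ℂ) - 1‖) atTop (𝓝 0) := by
          have h2 : Continuous fun x : Circle => ‖(x : ℂ) - 1‖ := by fun_prop
          have h3 := (h2.tendsto 1).comp (hf i)
          simpa [Function.comp_def] using h3
        simp_rw [Circle.coe_zpow] at h1
        have : (0 : ℝ) < j := by exact_mod_cast i.pos
        exact h1.eventually (eventually_le_nhds (by positivity))
      obtain ⟨K, hK⟩ := eventually_atTop.1 hev
      exact ⟨max j K, le_max_left _ _, fun _ k hk => hK k ((le_max_right _ _).trans hk)⟩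
    · exact ⟨j, le_rfl, fun h => absurd h hf⟩
  choose K hjK hK using hK
  obtain ⟨w, hw, hwD, hwS⟩ := exists_isTree (fun _ _ => (limitGroup n : Set Circle))
    (fun j f => (Finset.range (K j f)).image n) (fun _ => ⟨1, one_mem _⟩)
    (fun j f hf i ε hε => exists_mem_limitGroup_near hn (hf i) hε)
  set L : ℕ → ℕ := fun j => K j fun i => w i with hL
  -- At time `k` the powers of the points of index below `s k` are near `1`; the exceptional point
  -- allowed by the criterion for trees is the one of index `s k`.
  set s : ℕ → ℕ := fun k => Nat.findGreatest (fun j => L j ≤ k) k with hs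
  have hsle : ∀ j k, L j ≤ k → j ≤ s k := fun j k hk =>
    Nat.le_findGreatest ((hjK j _).trans hk) hk
  refine hw.isRigiditySequence (s := s) (ε := fun j => 1 / (j : ℝ))
    (tendsto_atTop.2 fun j => (eventually_ge_atTop (L j)).mono fun k hk => hsle j k hk)
    tendsto_one_div_atTop_nhds_zero_nat (fun j => by positivity) (fun k => ⟨s k, ?_⟩) ?_
  · intro i hi his
    have hlt : i < s k := lt_of_le_of_ne hi his
    have hLk : L (s k) ≤ k := by
      exact Nat.findGreatest_of_ne_zero (P := fun j => L j ≤ k) (n := k) rfl (by omega)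
    exact hK (s k) (fun i => w i) (fun i => hwD i) k hLk ⟨i, hlt⟩
  · intro k m i hi hsk
    refine hwS m i hi (n k) (Finset.mem_image_of_mem n (Finset.mem_range.2 ?_))
    by_contra hcon
    exact absurd (hsle (i + 2 ^ m) k (not_lt.1 hcon)) (not_le.2 hsk)

end InfiniteGroup

/-! ### A rigidity sequence whose limit group is trivial -/

section PrimeOrder

/-- The only point of the circle all of whose powers stay at distance at most `1` from `1` is `1`:
otherwise squaring multiplies the distance to `1` by at least `√3`. -/
theorem Circle.eq_one_of_forall_norm_pow_sub_one_le {u : Circle}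
    (h : ∀ r : ℕ, 0 < r → ‖(u : ℂ) ^ r - 1‖ ≤ 1) : u = 1 := by
  have hsq : ∀ v : Circle, ‖(v : ℂ) - 1‖ ≤ 1 → 3 * ‖(v : ℂ) - 1‖ ^ 2 ≤ ‖(v : ℂ) ^ 2 - 1‖ ^ 2 := by
    intro v hv
    have h1 : (v : ℂ) ^ 2 - 1 = ((v : ℂ) + 1) * ((v : ℂ) - 1) := by ring
    have h2 := parallelogram_law_with_norm ℝ (v : ℂ) 1
    rw [Circle.norm_coe, norm_one] at h2
    rw [h1, norm_mul, mul_pow]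
    have h3 := norm_nonneg ((v : ℂ) - 1)
    gcongr
    nlinarith
  have hpow : ∀ k : ℕ, 3 ^ k * ‖(u : ℂ) - 1‖ ^ 2 ≤ ‖(u : ℂ) ^ 2 ^ k - 1‖ ^ 2 := by
    intro k
    induction k with
    | zero => simp
    | succ k ih =>
      have := hsq (u ^ 2 ^ k) (by simpa using h (2 ^ k) (by positivity))
      rw [Circle.coe_pow] at this
      rw [pow_succ 2 k, pow_mul, pow_succ]
      linarith
  by_contra hu
  have hpos : 0 < ‖(u : ℂ) - 1‖ ^ 2 := by
    have : (u : ℂ) - 1 ≠ 0 := sub_ne_zero.2 fun h' => hu (Circle.coe_injective (by simpa using h'))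
    positivity
  obtain ⟨k, hk⟩ := pow_unbounded_of_one_lt (1 / ‖(u : ℂ) - 1‖ ^ 2) (show (1 : ℝ) < 3 by norm_num)
  rw [div_lt_iff₀ hpos] at hk
  have h1 := h (2 ^ k) (by positivity)
  have h2 := hpow k
  have h3 : ‖(u : ℂ) ^ 2 ^ k - 1‖ ^ 2 ≤ 1 := pow_le_one₀ (norm_nonneg _) h1
  linarith

/-- Points of large prime order are dense in the circle. -/
theorem Circle.exists_orderOf_eq_prime_near (v : Circle) {ε : ℝ} (hε : 0 < ε) :
    ∃ B : ℕ, ∀ p : ℕ, p.Prime → B ≤ p → ∃ x : Circle, orderOf x = p ∧ ‖(x : ℂ) - v‖ < ε := by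
  set θ := Complex.arg v with hθ
  have hv : Circle.exp θ = v := Circle.exp_arg v
  have hcont : Tendsto (fun t => ‖(Circle.exp t : ℂ) - v‖) (𝓝 θ) (𝓝 0) := by
    have : Continuous fun t => ‖(Circle.exp t : ℂ) - v‖ := by fun_prop
    simpa [hv] using this.tendsto θ
  obtain ⟨δ, hδ, hball⟩ := Metric.eventually_nhds_iff.1
    (hcont.eventually (eventually_lt_nhds hε))
  obtain ⟨B, hB⟩ := exists_nat_gt (2 * Real.pi / δ)
  refine ⟨B, fun p hp hBp => ?_⟩
  have hp0 : (0 : ℝ) < p := by exact_mod_cast hp.pos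
  have hpδ : 2 * Real.pi / p < δ := by
    rw [div_lt_iff₀ hδ] at hB
    rw [div_lt_iff₀ hp0]
    have : (B : ℝ) ≤ p := by exact_mod_cast hBp
    nlinarith
  have hpi := Real.pi_pos
  set a : ℤ := ⌊θ * p / (2 * Real.pi)⌋ with ha
  have ha1 : a * (2 * Real.pi) ≤ θ * p := by
    rw [← le_div_iff₀ (by positivity)]
    exact Int.floor_le _
  have ha2 : θ * p < (a + 1) * (2 * Real.pi) := by
    rw [← div_lt_iff₀ (by positivity)]
    exact Int.lt_floor_add_one _
  have hx : ∀ b : ℤ, |(b : ℝ) * (2 * Real.pi) - θ * p| ≤ 2 * Real.pi →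
      Circle.exp (b * (2 * Real.pi) / p) ≠ 1 →
      ∃ x : Circle, orderOf x = p ∧ ‖(x : ℂ) - v‖ < ε := by
    intro b hb hne
    have := Fact.mk hp
    refine ⟨Circle.exp (b * (2 * Real.pi) / p), orderOf_eq_prime ?_ hne, hball ?_⟩
    · rw [← Circle.exp_nsmul, nsmul_eq_mul, mul_div_cancel₀ _ hp0.ne']
      simp
    · rw [Real.dist_eq]
      refine lt_of_le_of_lt ?_ hpδ
      rw [show (b : ℝ) * (2 * Real.pi) / p - θ = (b * (2 * Real.pi) - θ * p) / p by field_simp,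
        abs_div, abs_of_pos hp0]
      gcongr
  by_cases h1 : Circle.exp (a * (2 * Real.pi) / p) = 1
  · refine hx (a + 1) ?_ fun h2 => ?_
    · push_cast
      rw [abs_le]
      constructor <;> linarith
    · have h3 : ((a + 1 : ℤ) : ℝ) * (2 * Real.pi) / p =
          a * (2 * Real.pi) / p + 2 * Real.pi / p := by push_cast; ring
      rw [h3, Circle.exp_add, h1, one_mul] at h2
      have h4 : 2 * Real.pi / p ≤ Real.pi := by
        rw [div_le_iff₀ hp0]
        have : (2 : ℝ) ≤ p := by exact_mod_cast hp.two_le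
        nlinarith
      have h5 := Circle.arg_exp (x := 2 * Real.pi / p) (by
        have : 0 < 2 * Real.pi / p := by positivity
        linarith) h4
      rw [h2] at h5
      simp only [Circle.coe_one, Complex.arg_one] at h5
      have : 0 < 2 * Real.pi / p := by positivity
      linarith
  · refine hx a ?_ h1
    rw [abs_le]
    constructor <;> linarith

/-- For finitely many points `g i` of distinct prime orders, finitely many exponents `n` such that
all but one of the powers `g i ^ n` equal `1` suffice to move every point at distance at least `ε`
from `1` away from `1`. -/
theorem exists_finset_exponents {ι : Type*} [Fintype ι] [Nonempty ι] {g : ι → Circle}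
    (hp : ∀ i, (orderOf (g i)).Prime) (hinj : ∀ i i', orderOf (g i) = orderOf (g i') → i = i')
    {ε : ℝ} (hε : 0 < ε) :
    ∃ F : Finset ℕ, (∀ n ∈ F, 0 < n ∧ ∃ i₀, ∀ i ≠ i₀, g i ^ n = 1) ∧
      ∀ z : Circle, (∀ n ∈ F, ‖(z : ℂ) ^ n - 1‖ ≤ 1) → ‖(z : ℂ) - 1‖ < ε := by
  classical
  let A : Set ℕ := {n | 0 < n ∧ ∃ i₀, ∀ i ≠ i₀, g i ^ n = 1}
  have hone : ∀ z : Circle, (∀ n ∈ A, ‖(z : ℂ) ^ n - 1‖ ≤ 1) → z = 1 := by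
    intro z hz
    have hQ : ∀ i₀, orderOf z ∣ ∏ i ∈ Finset.univ.erase i₀, orderOf (g i) := by
      intro i₀
      rw [orderOf_dvd_iff_pow_eq_one]
      refine Circle.eq_one_of_forall_norm_pow_sub_one_le fun r hr => ?_
      rw [Circle.coe_pow, ← pow_mul]
      refine hz _ ⟨Nat.mul_pos (Finset.prod_pos fun i _ => (hp i).pos) hr, i₀, fun i hi => ?_⟩
      rw [← orderOf_dvd_iff_pow_eq_one]
      exact (Finset.dvd_prod_of_mem (fun i => orderOf (g i)) (by simp [hi])).mul_right _
    rw [← orderOf_eq_one_iff]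
    by_contra hne
    -- A prime factor of the order of `z` is one of the primes `orderOf (g i)`, but it also divides
    -- the product of the others.
    obtain ⟨p, hpp, hpz⟩ := Nat.exists_prime_and_dvd hne
    have hfind : ∀ i₀, ∃ i ≠ i₀, p = orderOf (g i) := by
      intro i₀
      obtain ⟨i, hi, hpi⟩ := (hpp.prime.dvd_finsetProd_iff _).1 (hpz.trans (hQ i₀))
      exact ⟨i, (Finset.mem_erase.1 hi).1, (Nat.prime_dvd_prime_iff_eq hpp (hp i)).1 hpi⟩
    obtain ⟨i, -, hi⟩ := hfind (Classical.arbitrary ι)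
    obtain ⟨i', hne', hi'⟩ := hfind i
    exact hne' (hinj _ _ (hi'.symm.trans hi))
  have hcomp : IsCompact {z : Circle | ε ≤ ‖(z : ℂ) - 1‖} :=
    (isClosed_le continuous_const (by fun_prop)).isCompact
  obtain ⟨t, ht⟩ := hcomp.elim_finite_subcover
    (fun n : A => {z : Circle | 1 < ‖(z : ℂ) ^ (n : ℕ) - 1‖})
    (fun n => isOpen_lt continuous_const (by fun_prop)) (by
      intro z hz
      by_contra hcon
      simp only [Set.mem_iUnion, Set.mem_ofPred_eq, not_exists, not_lt] at hcon
      have := hone z fun n hn => hcon ⟨n, hn⟩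
      rw [this] at hz
      simp only [Set.mem_ofPred_eq, Circle.coe_one, sub_self, norm_zero] at hz
      linarith)
  refine ⟨t.image Subtype.val, fun n hn => ?_, fun z hz => ?_⟩
  · obtain ⟨n, -, rfl⟩ := Finset.mem_image.1 hn
    exact n.2
  · by_contra hcon
    obtain ⟨n, hn⟩ := Set.mem_iUnion.1 (ht (not_lt.1 hcon))
    obtain ⟨hnt, hn⟩ := Set.mem_iUnion.1 hn
    exact absurd (hz n (Finset.mem_image_of_mem _ hnt)) (not_le.2 hn)

/-- There is a rigidity sequence of positive integers along which the powers of no point of the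
circle but `1` tend to `1`. -/
theorem exists_isRigiditySequence_limitGroup_eq_bot :
    ∃ n : ℕ → ℤ, (∀ k, 0 < n k) ∧ IsRigiditySequence n ∧ limitGroup n = ⊥ := by
  classical
  -- The exponents in a good set for `g` kill all but one of the points `g i`, and detect all points
  -- that are not near `1`. `F j g` is such a set if there is one.
  let Good : ∀ j : ℕ, (Fin (j + 1) → Circle) → Finset ℕ → Prop := fun j g F =>
    (∀ n ∈ F, 0 < n ∧ ∃ i₀, ∀ i ≠ i₀, g i ^ n = 1) ∧
      ∀ z : Circle, (∀ n ∈ F, ‖(z : ℂ) ^ n - 1‖ ≤ 1) → ‖(z : ℂ) - 1‖ < 1 / ((j : ℝ) + 1)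
  let F : ∀ j : ℕ, (Fin (j + 1) → Circle) → Finset ℕ := fun j g =>
    if h : ∃ F, Good j g F then h.choose else ∅
  -- The new point of index `j` has a new prime order and follows its parent for all the exponents
  -- chosen so far, those in `F l` for `l < j`.
  obtain ⟨w, hw, hwC, hwS⟩ := exists_isTree
    (fun j f => {x | (orderOf x).Prime ∧ ∀ i, orderOf x ≠ orderOf (f i)})
    (fun j f => Finset.univ.biUnion fun l : Fin j =>
      (F l fun i : Fin (l + 1) => f ⟨i, (Nat.lt_succ_iff.1 i.2).trans_lt l.2⟩).image Nat.cast)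
    (fun f => by
      obtain ⟨B, hB⟩ := Circle.exists_orderOf_eq_prime_near 1 one_pos
      obtain ⟨p, hp, hpp⟩ := Nat.exists_infinite_primes B
      obtain ⟨x, hx, -⟩ := hB p hpp hp
      exact ⟨x, by rwa [hx], fun i => i.elim0⟩)
    (fun j f hf i ε hε => by
      obtain ⟨B, hB⟩ := Circle.exists_orderOf_eq_prime_near (f i) hε
      obtain ⟨p, hp, hpp⟩ := Nat.exists_infinite_primes (B + ∑ l, orderOf (f l) + 1)
      obtain ⟨x, hx, hxv⟩ := hB p hpp (by omega)
      have hne : ∀ l, orderOf x ≠ orderOf (f l) := fun l h => by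
        have := Finset.single_le_sum (f := fun l => orderOf (f l)) (fun _ _ => Nat.zero_le _)
          (Finset.mem_univ l)
        omega
      exact ⟨x, ⟨by rwa [hx], hne⟩, fun h => hne i (by rw [h]), hxv⟩)
  have hinj : ∀ a b, orderOf (w a) = orderOf (w b) → a = b := by
    intro a b hab
    by_contra hne
    rcases lt_or_gt_of_ne hne with h | h
    · exact (hwC b).2 ⟨a, h⟩ hab.symm
    · exact (hwC a).2 ⟨b, h⟩ hab
  let G : ℕ → Finset ℕ := fun j => F j fun i => w i
  have hG : ∀ j, Good j (fun i => w i) (G j) := by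
    intro j
    have hex : ∃ F, Good j (fun i => w i) F :=
      exists_finset_exponents (g := fun i : Fin (j + 1) => w i) (fun i => (hwC i).1)
        (fun i i' h => Fin.ext (hinj _ _ h)) (by positivity)
    simp only [G, F]
    rw [dif_pos hex]
    exact hex.choose_spec
  have hGne : ∀ j, (G j).Nonempty := by
    intro j
    by_contra hcon
    rw [Finset.not_nonempty_iff_eq_empty] at hcon
    have := (hG j).2 (-1) (by simp [hcon])
    have h2 : ‖((-1 : Circle) : ℂ) - 1‖ = 2 := by
      rw [Circle.coe_neg, Circle.coe_one]; norm_num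
    rw [h2, lt_div_iff₀ (by positivity)] at this
    have : (0 : ℝ) ≤ j := by positivity
    linarith
  -- The sequence enumerates the disjoint union of the sets `G j`.
  have : Infinite (Σ j, G j) :=
    Infinite.of_injective (fun j => (⟨j, (hGne j).choose, (hGne j).choose_spec⟩ : Σ j, G j))
      fun a b h => congrArg Sigma.fst h
  obtain ⟨e⟩ := nonempty_equiv_of_countable (α := ℕ) (β := Σ j, G j)
  have hfin : ∀ j, {p : Σ j, G j | p.1 < j}.Finite := by
    intro j
    refine ((Finset.range j).sigma fun l => (G l).attach).finite_toSet.subset ?_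
    intro p hp
    simpa using hp
  have hs : Tendsto (fun k => (e k).1) atTop atTop := by
    refine tendsto_atTop.2 fun j => ?_
    rw [← Nat.cofinite_eq_atTop, eventually_cofinite]
    simp only [not_le]
    exact (hfin j).preimage e.injective.injOn
  refine ⟨fun k => ((e k).2 : ℕ), fun k => ?_, ?_, ?_⟩
  · have := ((hG (e k).1).1 _ (e k).2.2).1
    exact Int.natCast_pos.2 this
  · refine hw.isRigiditySequence hs (ε := fun _ => 0) tendsto_const_nhds (fun _ => le_rfl)
      (fun k => ?_) ?_
    · obtain ⟨i₀, hi₀⟩ := ((hG (e k).1).1 _ (e k).2.2).2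
      refine ⟨i₀, fun i hi hne => ?_⟩
      have := hi₀ ⟨i, Nat.lt_succ_iff.2 hi⟩ fun h => hne (congrArg Fin.val h)
      rw [zpow_natCast, ← Circle.coe_pow, this]
      simp
    · intro k m i hi hk
      refine hwS m i hi _ (Finset.mem_biUnion.2 ⟨⟨(e k).1, hk⟩, Finset.mem_univ _, ?_⟩)
      exact Finset.mem_image_of_mem _ (e k).2.2
  · rw [Subgroup.eq_bot_iff_forall]
    intro z hz
    have hev : ∀ᶠ k in atTop, ‖(z : ℂ) ^ ((e k).2 : ℕ) - 1‖ ≤ 1 := by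
      have h2 : Continuous fun x : Circle => ‖(x : ℂ) - 1‖ := by fun_prop
      have h3 := (h2.tendsto 1).comp (show Tendsto (fun k => z ^ (((e k).2 : ℕ) : ℤ)) atTop (𝓝 1)
        from hz)
      simp only [Function.comp_def, zpow_natCast, Circle.coe_pow, Circle.coe_one, sub_self,
        norm_zero] at h3
      exact h3.eventually (eventually_le_nhds one_pos)
    rw [← Nat.cofinite_eq_atTop, eventually_cofinite] at hev
    obtain ⟨J, hJ⟩ := (hev.image fun k => (e k).1).bddAbove
    have hlt : ∀ j, J < j → ‖(z : ℂ) - 1‖ < 1 / ((j : ℝ) + 1) := by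
      intro j hj
      refine (hG j).2 z fun n hn => ?_
      by_contra hcon
      obtain ⟨k, hk⟩ := e.surjective ⟨j, n, hn⟩
      have h1 : (e k).1 ≤ J := hJ (Set.mem_image_of_mem _ (by
        rw [Set.mem_ofPred_eq, hk]
        exact hcon))
      rw [hk] at h1
      exact absurd h1 (not_le.2 hj)
    have h0 : ‖(z : ℂ) - 1‖ ≤ 0 :=
      ge_of_tendsto tendsto_one_div_add_atTop_nhds_zero_nat
        ((eventually_gt_atTop J).mono fun j hj => (hlt j hj).le)
    exact Circle.coe_injective (by simpa [sub_eq_zero] using norm_le_zero_iff.1 h0)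

end PrimeOrder

/-! ### Fejér sums of positive definite functions -/

section PositiveDefinite

/-- Shifting the summation range by `n` changes a sum of bounded terms by at most `2 |n|` terms. -/
theorem norm_sum_range_shift_sub_le {F : ℤ → ℂ} {B : ℝ} (hF : ∀ k, ‖F k‖ ≤ B) (M : ℕ) (n : ℤ) :
    ‖∑ k ∈ Finset.range M, F (k + n) - ∑ k ∈ Finset.range M, F k‖ ≤ 2 * |(n : ℝ)| * B := by
  have hnat : ∀ (F : ℤ → ℂ), (∀ k, ‖F k‖ ≤ B) → ∀ d : ℕ,
      ‖∑ k ∈ Finset.range M, F (k + d) - ∑ k ∈ Finset.range M, F k‖ ≤ 2 * d * B := by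
    intro F hF d
    have h1 := Finset.sum_range_add (fun k : ℕ => F k) M d
    have h2 := Finset.sum_range_add (fun k : ℕ => F k) d M
    rw [add_comm d M, h1] at h2
    have h3 : ∑ k ∈ Finset.range M, F (k + d) - ∑ k ∈ Finset.range M, F k =
        ∑ k ∈ Finset.range d, F ((M + k : ℕ) : ℤ) - ∑ k ∈ Finset.range d, F k := by
      have h4 : ∑ k ∈ Finset.range M, F (k + d) = ∑ k ∈ Finset.range M, F ((d + k : ℕ) : ℤ) :=
        Finset.sum_congr rfl fun k _ => by push_cast; rw [add_comm]
      rw [h4]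
      linear_combination -h2
    have hb : ∀ G : ℕ → ℂ, (∀ k, ‖G k‖ ≤ B) → ‖∑ k ∈ Finset.range d, G k‖ ≤ d * B := fun G hG => by
      refine (norm_sum_le_of_le _ fun k _ => hG k).trans ?_
      simp
    rw [h3]
    refine (norm_sub_le _ _).trans ?_
    have h5 := hb (fun k => F ((M + k : ℕ) : ℤ)) fun k => hF _
    have h6 := hb (fun k => F k) fun k => hF _
    linarith
  rcases Int.eq_nat_or_neg n with ⟨d, rfl | rfl⟩
  · simpa using hnat F hF d
  · have := hnat (fun k => F (k + -(d : ℤ))) (fun k => hF _) d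
    simp only [add_neg_cancel_right] at this
    rw [norm_sub_rev]
    simpa using this

/-- Orthogonality of the powers of the `R`-th roots of unity. -/
theorem sum_zpow_rootOfUnity {R : ℕ} (hR : R ≠ 0) {m : ℤ} (hm : |m| < R) :
    ∑ j ∈ Finset.range R, ((Circle.exp (2 * Real.pi / R) ^ j : Circle) : ℂ) ^ m =
      if m = 0 then (R : ℂ) else 0 := by
  have hprim := Complex.isPrimitiveRoot_exp R hR
  have hω : (Circle.exp (2 * Real.pi / R) : ℂ) = Complex.exp (2 * Real.pi * Complex.I / R) := by
    rw [Circle.coe_exp]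
    congr 1
    push_cast
    ring
  rw [← hω] at hprim
  set ω := Circle.exp (2 * Real.pi / R)
  split_ifs with h
  · simp [h]
  · have h1 : ∀ j : ℕ, ((ω ^ j : Circle) : ℂ) ^ m = ((ω : ℂ) ^ m) ^ j := fun j => by
      rw [Circle.coe_pow, ← zpow_natCast, ← zpow_natCast, zpow_comm]
    simp_rw [h1]
    have hne : (ω : ℂ) ^ m ≠ 1 := fun h2 => by
      have := (hprim.zpow_eq_one_iff_dvd m).1 h2
      exact h (Int.eq_zero_of_abs_lt_dvd this hm)
    have h3 := geom_sum_mul ((ω : ℂ) ^ m) R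
    have h4 : ((ω : ℂ) ^ m) ^ R = 1 := by
      rw [← zpow_natCast, zpow_comm, zpow_natCast, hprim.pow_eq_one, one_zpow]
    rw [h4, sub_self] at h3
    exact (mul_eq_zero.1 h3).resolve_right (sub_ne_zero.2 hne)

variable {r : ℤ → ℝ} {I : ℕ → Circle → ℝ}

/-- Let `I M z` be the Fejér sums of a positive definite function `r`. A uniform bound for `I N`
gives a bound for the sum of the squares `r (k - l) ^ 2`. The Fejér sums of length `2 * N`, sampled at
`4 * N`-th roots of unity, serve as positive weights. -/
theorem sum_sq_le_of_fejerSum_le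
    (hI : ∀ M z, (I M z : ℂ) = ∑ k ∈ Finset.range M, ∑ l ∈ Finset.range M,
      (r (k - l) : ℂ) * (z : ℂ) ^ ((l : ℤ) - k)) (hI0 : ∀ M z, 0 ≤ I M z) {N : ℕ} (hN : 0 < N) {s : ℝ}
    (hs : ∀ z, I N z ≤ s * (N : ℝ) ^ 2) :
    ∑ k ∈ Finset.range N, ∑ l ∈ Finset.range N, r (k - l) ^ 2 ≤ 2 * s * r 0 * (N : ℝ) ^ 2 := by
  set R := 4 * N with hR
  have hR0 : R ≠ 0 := by omega
  set z : ℕ → Circle := fun j => Circle.exp (2 * Real.pi / R) ^ j with hz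
  have horth : ∀ m : ℤ, |m| < R → ∑ j ∈ Finset.range R, (z j : ℂ) ^ m = if m = 0 then (R : ℂ) else 0 :=
    fun m hm => sum_zpow_rootOfUnity hR0 hm
  -- The weights have total mass `2 * N * R * r 0`.
  have hmass : ∑ j ∈ Finset.range R, I (2 * N) (z j)⁻¹ = R * (2 * N * r 0) := by
    have : ((∑ j ∈ Finset.range R, I (2 * N) (z j)⁻¹ : ℝ) : ℂ) = (R * (2 * N * r 0) : ℝ) := by
      push_cast
      simp_rw [hI, Circle.coe_inv, inv_zpow']
      rw [Finset.sum_comm]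
      simp_rw [Finset.sum_comm (s := Finset.range R), ← Finset.mul_sum]
      have h1 : ∀ c ∈ Finset.range (2 * N), ∑ e ∈ Finset.range (2 * N),
          (r ((c : ℤ) - e) : ℂ) * ∑ j ∈ Finset.range R, (z j : ℂ) ^ (-((e : ℤ) - c)) =
          R * r 0 := by
        intro c hc
        rw [Finset.sum_eq_single c]
        · rw [horth _ (by simp; omega)]
          simp [mul_comm]
        · intro e he hec
          simp only [Finset.mem_range] at hc he
          rw [horth _ (by rw [abs_lt]; constructor <;> omega), if_neg (by omega), mul_zero]
        · exact fun h => absurd hc h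
      rw [Finset.sum_congr rfl h1]
      simp
      ring
    exact_mod_cast this
  have hupper : ∑ j ∈ Finset.range R, I N (z j) * I (2 * N) (z j)⁻¹ ≤
      s * (N : ℝ) ^ 2 * (R * (2 * N * r 0)) := by
    rw [← hmass, Finset.mul_sum]
    exact Finset.sum_le_sum fun j _ => mul_le_mul_of_nonneg_right (hs _) (hI0 _ _)
  have hlower : ∑ j ∈ Finset.range R, I N (z j) * I (2 * N) (z j)⁻¹ =
      ∑ k ∈ Finset.range N, ∑ l ∈ Finset.range N, ∑ p ∈ Finset.range (2 * N) ×ˢ Finset.range (2 * N),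
        r (k - l) * r (p.1 - p.2) * (if (l : ℤ) - k + (p.1 - p.2) = 0 then (R : ℝ) else 0) := by
    have : ((∑ j ∈ Finset.range R, I N (z j) * I (2 * N) (z j)⁻¹ : ℝ) : ℂ) =
        ((∑ k ∈ Finset.range N, ∑ l ∈ Finset.range N,
        ∑ p ∈ Finset.range (2 * N) ×ˢ Finset.range (2 * N), r (k - l) * r (p.1 - p.2) *
          (if (l : ℤ) - k + (p.1 - p.2) = 0 then (R : ℝ) else 0) : ℝ) : ℂ) := by
      push_cast
      simp_rw [hI, Circle.coe_inv, inv_zpow', Finset.sum_mul]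
      rw [Finset.sum_comm]
      refine Finset.sum_congr rfl fun k hk => ?_
      rw [Finset.sum_comm]
      refine Finset.sum_congr rfl fun l hl => ?_
      simp_rw [← Finset.sum_product', Finset.mul_sum]
      rw [Finset.sum_comm]
      refine Finset.sum_congr rfl fun p hp => ?_
      simp only [Finset.mem_product, Finset.mem_range] at hk hl hp
      have h1 : (((if (l : ℤ) - k + (p.1 - p.2) = 0 then (R : ℝ) else 0 : ℝ)) : ℂ) =
          ∑ j ∈ Finset.range R, (z j : ℂ) ^ ((l : ℤ) - k + ((p.1 : ℤ) - p.2)) := by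
        rw [horth _ (by rw [abs_lt]; constructor <;> omega)]
        split_ifs <;> simp
      rw [h1, Finset.mul_sum]
      refine Finset.sum_congr rfl fun j _ => ?_
      rw [zpow_add₀ (z j).coe_ne_zero, neg_sub]
      ring
    exact_mod_cast this
  have hterm : ∀ k ∈ Finset.range N, ∀ l ∈ Finset.range N, r (k - l) ^ 2 * (R * N) ≤
      ∑ p ∈ Finset.range (2 * N) ×ˢ Finset.range (2 * N),
        r (k - l) * r (p.1 - p.2) * (if (l : ℤ) - k + (p.1 - p.2) = 0 then (R : ℝ) else 0) := by
    intro k hk l hl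
    rw [Finset.mem_range] at hk hl
    -- The pairs `(k + t, l + t)` contribute `R * r (k - l) ^ 2` each.
    have hsub : (Finset.range N).image (fun t => (k + t, l + t)) ⊆
        Finset.range (2 * N) ×ˢ Finset.range (2 * N) := by
      intro p hp
      obtain ⟨t, ht, rfl⟩ := Finset.mem_image.1 hp
      simp only [Finset.mem_range, Finset.mem_product] at ht ⊢
      omega
    refine le_trans (le_of_eq ?_) (Finset.sum_le_sum_of_subset_of_nonneg hsub fun p _ _ => ?_)
    · rw [Finset.sum_image (fun a _ b _ h => by simpa using congrArg Prod.fst h)]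
      have : ∀ t ∈ Finset.range N, r (k - l) * r (((k + t : ℕ) : ℤ) - (l + t : ℕ)) *
          (if (l : ℤ) - k + (((k + t : ℕ) : ℤ) - (l + t : ℕ)) = 0 then (R : ℝ) else 0) =
          r (k - l) ^ 2 * R := by
        intro t _
        have h1 : ((k + t : ℕ) : ℤ) - (l + t : ℕ) = k - l := by push_cast; ring
        rw [h1, if_pos (by ring)]
        ring
      rw [Finset.sum_congr rfl this]
      simp
      ring
    · split_ifs with h
      · have h1 : (p.1 : ℤ) - p.2 = k - l := by omega
        rw [h1]
        have := mul_self_nonneg (r (k - l))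
        positivity
      · simp
  have hfinal := (Finset.sum_le_sum fun k hk => Finset.sum_le_sum fun l hl => hterm k hk l hl).trans
    (hlower.symm.le.trans hupper)
  simp_rw [← Finset.sum_mul] at hfinal
  have hRN : (0 : ℝ) < R * N := by positivity
  refine le_of_mul_le_mul_right (hfinal.trans (le_of_eq ?_)) hRN
  ring

/-- If the squares of a positive definite function do not tend to `0` on average, then its Fejér
sums are of maximal order at some point of the circle. -/
theorem exists_fejerSum_ge
    (hI : ∀ M z, (I M z : ℂ) = ∑ k ∈ Finset.range M, ∑ l ∈ Finset.range M,
      (r (k - l) : ℂ) * (z : ℂ) ^ ((l : ℤ) - k)) (hI0 : ∀ M z, 0 ≤ I M z)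
    (hI2 : ∀ M z, I (2 * M) z ≤ 4 * I M z) {c : ℝ} (hc : 0 < c)
    (hr : ∀ N : ℕ, c * (N : ℝ) ^ 2 ≤ ∑ k ∈ Finset.range N, ∑ l ∈ Finset.range N, r (k - l) ^ 2) :
    ∃ z, ∃ s > 0, ∀ j : ℕ, s * ((2 ^ j : ℕ) : ℝ) ^ 2 ≤ I (2 ^ j) z := by
  have hr0 : 0 ≤ r 0 := by
    have := hI 1 1
    simp only [Finset.range_one, Finset.sum_singleton, CharP.cast_eq_zero, sub_self, zpow_zero,
      mul_one] at this
    have h1 : I 1 1 = r 0 := by exact_mod_cast this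
    rw [← h1]
    exact hI0 _ _
  set s := c / (2 * r 0 + 1) / 2 with hs
  have hs0 : 0 < s := by positivity
  have hcont : ∀ M, Continuous (I M) := by
    intro M
    have h1 : I M = fun z => (∑ k ∈ Finset.range M, ∑ l ∈ Finset.range M,
      (r (k - l) : ℂ) * ((z ^ ((l : ℤ) - k) : Circle) : ℂ)).re := by
      funext z
      simp_rw [Circle.coe_zpow]
      rw [← hI, Complex.ofReal_re]
    rw [h1]
    refine Complex.continuous_re.comp (continuous_finsetSum _ fun k _ => continuous_finsetSum _
      fun l _ => continuous_const.mul (continuous_subtype_val.comp (continuous_zpow _)))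
  -- The closed sets `Z j` decrease, since doubling the length multiplies `I` by at most `4`, and none
  -- is empty, since otherwise the squares `r (k - l) ^ 2` would be too small on average.
  let Z : ℕ → Set Circle := fun j => {z | s * ((2 ^ j : ℕ) : ℝ) ^ 2 ≤ I (2 ^ j) z}
  have hZ : (⋂ j, Z j).Nonempty := by
    refine IsCompact.nonempty_iInter_of_sequence_nonempty_isCompact_isClosed Z (fun j z hz => ?_)
      (fun j => ?_) (isClosed_le continuous_const (hcont _)).isCompact
      fun j => isClosed_le continuous_const (hcont _)
    · have h1 := hI2 (2 ^ j) z
      have h2 : s * ((2 ^ (j + 1) : ℕ) : ℝ) ^ 2 ≤ I (2 ^ (j + 1)) z := hz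
      rw [pow_succ' 2 j] at h2
      push_cast at h2
      change s * ((2 ^ j : ℕ) : ℝ) ^ 2 ≤ I (2 ^ j) z
      push_cast
      nlinarith
    · by_contra hcon
      rw [Set.not_nonempty_iff_eq_empty, Set.eq_empty_iff_forall_notMem] at hcon
      have h1 := sum_sq_le_of_fejerSum_le hI hI0 (N := 2 ^ j) (by positivity) (s := s)
        fun z => (not_le.1 (hcon z)).le
      have h2 := (hr (2 ^ j)).trans h1
      have h3 : (0 : ℝ) < ((2 ^ j : ℕ) : ℝ) ^ 2 := by positivity
      have h4 := le_of_mul_le_mul_right h2 h3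
      have h5 : 2 * s * r 0 = c * (r 0 / (2 * r 0 + 1)) := by rw [hs]; field_simp
      have h6 : r 0 / (2 * r 0 + 1) < 1 := by rw [div_lt_one (by positivity)]; linarith
      nlinarith
  obtain ⟨z, hz⟩ := hZ
  exact ⟨z, s, hs0, fun j => Set.mem_iInter.1 hz j⟩

end PositiveDefinite

/-! ### Characters of subgroups of compact groups -/

section CompactGroup

theorem Continuous.integrable_of_compactSpace {X E : Type*} [TopologicalSpace X] [CompactSpace X]
    [MeasurableSpace X] [BorelSpace X] {μ : Measure X} [IsFiniteMeasure μ] [NormedAddCommGroup E]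
    {f : X → E} (hf : Continuous f) : Integrable f μ :=
  hf.integrable_of_hasCompactSupport (HasCompactSupport.of_compactSpace f)

variable {K : Type*} [AddCommGroup K]

/-- The sum `∑ g (x + k • a) z⁻ᵏ` over `0 ≤ k < M`: the Fourier sum at `z` of `g` along the orbit of
`x` under the rotation by `a`. -/
noncomputable def orbitSum (g : K → ℝ) (a : K) (z : Circle) (M : ℕ) (x : K) : ℂ :=
  ∑ k ∈ Finset.range M, (g (x + (k : ℤ) • a) : ℂ) * (z : ℂ) ^ (-(k : ℤ))

theorem orbitSum_two_mul (g : K → ℝ) (a : K) (z : Circle) (M : ℕ) (x : K) :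
    orbitSum g a z (2 * M) x =
      orbitSum g a z M x + (z : ℂ) ^ (-(M : ℤ)) * orbitSum g a z M (x + (M : ℤ) • a) := by
  unfold orbitSum
  rw [two_mul, Finset.sum_range_add, Finset.mul_sum]
  congr 1
  refine Finset.sum_congr rfl fun k _ => ?_
  rw [Nat.cast_add, add_smul, neg_add, zpow_add₀ z.coe_ne_zero, add_assoc]
  ring

/-- If rotating by `n • a` moves `g` by at most `η` uniformly, then `z ^ n - 1` nearly annihilates
the orbit sums of `g` at `z`. -/
theorem norm_zpow_sub_one_mul_orbitSum_le {g : K → ℝ} {B η : ℝ} (hB : ∀ x, |g x| ≤ B) {a : K} {n : ℤ}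
    (hη : ∀ y, |g (y + n • a) - g y| ≤ η) (z : Circle) (M : ℕ) (x : K) :
    ‖(z : ℂ) ^ n - 1‖ * ‖orbitSum g a z M x‖ ≤ M * η + 2 * |(n : ℝ)| * B := by
  set F : ℤ → ℂ := fun k => (g (x + k • a) : ℂ) * (z : ℂ) ^ (-k) with hF
  have hFB : ∀ k, ‖F k‖ ≤ B := fun k => by
    rw [hF, norm_mul, Circle.norm_coe_zpow, mul_one, Complex.norm_real]
    exact hB _
  have h1 := norm_sum_range_shift_sub_le hFB M n
  have h2 : ‖∑ k ∈ Finset.range M, ((z : ℂ) ^ n * F (k + n) - F k)‖ ≤ M * η := by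
    refine (norm_sum_le_of_le (f := fun k : ℕ => (z : ℂ) ^ n * F (k + n) - F k)
      (n := fun _ => η) _ fun k _ => ?_).trans (by simp)
    have h3 : (z : ℂ) ^ n * F (k + n) - F k =
        ((g (x + (k : ℤ) • a + n • a) - g (x + (k : ℤ) • a) : ℝ) : ℂ) * (z : ℂ) ^ (-(k : ℤ)) := by
      simp only [hF]
      rw [neg_add, zpow_add₀ z.coe_ne_zero, add_smul, ← add_assoc, zpow_neg _ n]
      have : (z : ℂ) ^ n ≠ 0 := zpow_ne_zero _ z.coe_ne_zero
      field_simp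
      push_cast
      ring
    rw [h3, norm_mul, Circle.norm_coe_zpow, mul_one, Complex.norm_real]
    exact hη _
  rw [← norm_mul]
  have h4 : ((z : ℂ) ^ n - 1) * orbitSum g a z M x =
      ∑ k ∈ Finset.range M, ((z : ℂ) ^ n * F (k + n) - F k) -
        (z : ℂ) ^ n * (∑ k ∈ Finset.range M, F (k + n) - ∑ k ∈ Finset.range M, F k) := by
    rw [Finset.sum_sub_distrib, ← Finset.mul_sum]
    change (_ - 1) * ∑ k ∈ Finset.range M, F k = _
    ring
  rw [h4]
  refine (norm_sub_le _ _).trans (add_le_add h2 ?_)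
  rwa [norm_mul, Circle.norm_coe_zpow, one_mul]

/-- For a coboundary `h (x + d • a) - h x`, the orbit sums telescope at `d`-th roots of unity. -/
theorem norm_orbitSum_coboundary_le {h : K → ℝ} {B : ℝ} (hB : ∀ x, |h x| ≤ B) {a : K} {d : ℕ}
    {z : Circle} (hz : z ^ d = 1) (M : ℕ) (x : K) :
    ‖orbitSum (fun x => h (x + d • a) - h x) a z M x‖ ≤ 2 * d * B := by
  set F : ℤ → ℂ := fun k => (h (x + k • a) : ℂ) * (z : ℂ) ^ (-k) with hF
  have hFB : ∀ k, ‖F k‖ ≤ B := fun k => by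
    rw [hF, norm_mul, Circle.norm_coe_zpow, mul_one, Complex.norm_real]
    exact hB _
  have h1 := norm_sum_range_shift_sub_le hFB M d
  have h2 : (z : ℂ) ^ (-(d : ℤ)) = 1 := by
    rw [zpow_neg, zpow_natCast, ← Circle.coe_pow, hz, Circle.coe_one, inv_one]
  have h3 : orbitSum (fun x => h (x + d • a) - h x) a z M x =
      ∑ k ∈ Finset.range M, F (k + (d : ℤ)) - ∑ k ∈ Finset.range M, F k := by
    rw [← Finset.sum_sub_distrib]
    refine Finset.sum_congr rfl fun k _ => ?_
    simp only [hF]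
    rw [neg_add, zpow_add₀ z.coe_ne_zero, h2, add_smul, ← add_assoc, natCast_zsmul a d]
    push_cast
    ring
  rw [h3]
  simpa using h1

variable [TopologicalSpace K]

theorem continuous_orbitSum [ContinuousAdd K] {g : K → ℝ} (hg : Continuous g) (a : K) (z : Circle)
    (M : ℕ) : Continuous (orbitSum g a z M) := by
  unfold orbitSum
  fun_prop

variable [IsTopologicalAddGroup K] [CompactSpace K]

theorem Continuous.eventually_forall_abs_add_sub_le {g : K → ℝ} (hg : Continuous g) {η : ℝ}
    (hη : 0 < η) : ∀ᶠ x in 𝓝 (0 : K), ∀ y, |g (y + x) - g y| ≤ η := by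
  have h := isCompact_univ.eventually_forall_of_forall_eventually (x₀ := (0 : K))
    (P := fun x y : K => |g (y + x) - g y| < η) (K := Set.univ) fun y _ => by
      have hc : Continuous fun p : K × K => |g (p.2 + p.1) - g p.2| := by fun_prop
      exact hc.continuousAt.eventually_lt_const (by simpa using hη)
  filter_upwards [h] with x hx y using (hx y trivial).le

/-- The differences of a sequence in a compact group lie in a given neighbourhood of `0` with positive
frequency, by the pigeonhole principle. -/
theorem exists_card_sq_le_sum_ite_sub_mem {V : Set K} (hV : V ∈ 𝓝 (0 : K)) (u : ℕ → K)
    [∀ x, Decidable (x ∈ V)] :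
    ∃ c > (0 : ℝ), ∀ N : ℕ, c * (N : ℝ) ^ 2 ≤
      ∑ k ∈ Finset.range N, ∑ l ∈ Finset.range N, if u k - u l ∈ V then (1 : ℝ) else 0 := by
  classical
  have hsub : Tendsto (fun p : K × K => p.1 - p.2) (𝓝 0 ×ˢ 𝓝 0) (𝓝 0) := by
    have := (by fun_prop : Continuous fun p : K × K => p.1 - p.2).tendsto (0, 0)
    rwa [nhds_prod_eq, sub_zero] at this
  obtain ⟨W, hW, hWV⟩ := Filter.mem_prod_same_iff.1 (hsub hV)
  obtain ⟨t, ht⟩ := CompactSpace.elim_nhds_subcover (fun y : K => (fun x => x - y) ⁻¹' W) fun y => by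
    have hc : Continuous fun x : K => x - y := by fun_prop
    exact hc.continuousAt (by simpa using hW)
  have hcol : ∀ x : K, ∃ y ∈ t, x - y ∈ W := fun x => by
    have : x ∈ (⊤ : Set K) := trivial
    rw [← ht] at this
    simpa using this
  -- Points of the same colour have their difference in `V`.
  choose col hcolt hcolW using hcol
  have ht0 : 0 < t.card := Finset.card_pos.2 ⟨_, hcolt 0⟩
  refine ⟨1 / t.card, by positivity, fun N => ?_⟩
  have h1 : ∑ k ∈ Finset.range N, ∑ l ∈ Finset.range N,
      (if col (u k) = col (u l) then (1 : ℝ) else 0) =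
      ∑ y ∈ t, (∑ k ∈ Finset.range N, if col (u k) = y then (1 : ℝ) else 0) ^ 2 := by
    simp_rw [sq, Finset.sum_mul_sum]
    rw [Finset.sum_comm]
    simp_rw [Finset.sum_comm (s := t)]
    rw [Finset.sum_comm]
    refine Finset.sum_congr rfl fun k _ => Finset.sum_congr rfl fun l _ => ?_
    simp_rw [ite_mul, one_mul, zero_mul]
    rw [Finset.sum_ite_eq t (col (u k)), if_pos (hcolt _)]
    simp only [eq_comm]
  have h2 : ∑ y ∈ t, (∑ k ∈ Finset.range N, if col (u k) = y then (1 : ℝ) else 0) = N := by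
    rw [Finset.sum_comm]
    simp [hcolt]
  have h3 := sq_sum_le_card_mul_sum_sq (s := t)
    (f := fun y => ∑ k ∈ Finset.range N, if col (u k) = y then (1 : ℝ) else 0)
  rw [h2, ← h1] at h3
  rw [one_div, inv_mul_le_iff₀ (by positivity)]
  refine h3.trans (mul_le_mul_of_nonneg_left ?_ (by positivity))
  refine Finset.sum_le_sum fun k _ => Finset.sum_le_sum fun l _ => ?_
  by_cases h : col (u k) = col (u l)
  · have h4 : u k - u l ∈ V := by
      have := hWV (Set.mk_mem_prod (hcolW (u k)) (h ▸ hcolW (u l)))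
      simpa using this
    simp [h4, h]
  · rw [if_neg h]
    split_ifs <;> norm_num

variable [MeasurableSpace K] [BorelSpace K] {μ : Measure K} [IsFiniteMeasure μ]

/-- The squared `L²` norms of the orbit sums are the Fejér sums of the autocorrelation of `g`. -/
theorem integral_norm_orbitSum_sq [μ.IsAddRightInvariant]
    {g : K → ℝ} (hg : Continuous g) (a : K) (M : ℕ) (z : Circle) :
    ((∫ x, ‖orbitSum g a z M x‖ ^ 2 ∂μ : ℝ) : ℂ) =
      ∑ k ∈ Finset.range M, ∑ l ∈ Finset.range M,
        ((∫ x, g (x + ((k : ℤ) - l) • a) * g x ∂μ : ℝ) : ℂ) * (z : ℂ) ^ ((l : ℤ) - k) := by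
  have h1 : ∀ x, ((‖orbitSum g a z M x‖ ^ 2 : ℝ) : ℂ) =
      ∑ k ∈ Finset.range M, ∑ l ∈ Finset.range M,
        ((g (x + (k : ℤ) • a) * g (x + (l : ℤ) • a) : ℝ) : ℂ) * (z : ℂ) ^ ((l : ℤ) - k) := by
    intro x
    rw [Complex.ofReal_pow, ← Complex.mul_conj', orbitSum, map_sum, Finset.sum_mul_sum]
    refine Finset.sum_congr rfl fun k _ => Finset.sum_congr rfl fun l _ => ?_
    rw [map_mul, Complex.conj_ofReal, map_zpow₀, ← Circle.coe_inv_eq_conj, Circle.coe_inv,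
      inv_zpow', neg_neg, sub_eq_neg_add, zpow_add₀ z.coe_ne_zero]
    push_cast
    ring
  rw [← integral_complex_ofReal]
  simp_rw [h1]
  rw [integral_finsetSum _ fun k _ => Continuous.integrable_of_compactSpace (by fun_prop)]
  refine Finset.sum_congr rfl fun k _ => ?_
  rw [integral_finsetSum _ fun l _ => Continuous.integrable_of_compactSpace (by fun_prop)]
  refine Finset.sum_congr rfl fun l _ => ?_
  rw [integral_mul_const, integral_complex_ofReal]
  congr 2
  rw [← integral_add_right_eq_self (μ := μ) (fun x => g (x + ((k : ℤ) - l) • a) * g x) ((l : ℤ) • a)]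
  refine integral_congr_ae (.of_forall fun x => ?_)
  simp only [add_assoc, ← add_smul]
  rw [add_sub_cancel]

theorem integral_norm_orbitSum_two_mul_sq_le [μ.IsAddRightInvariant]
    {g : K → ℝ} (hg : Continuous g) (a : K) (M : ℕ)
    (z : Circle) :
    ∫ x, ‖orbitSum g a z (2 * M) x‖ ^ 2 ∂μ ≤ 4 * ∫ x, ‖orbitSum g a z M x‖ ^ 2 ∂μ := by
  have hc := continuous_orbitSum hg a z
  have h1 : ∀ x, ‖orbitSum g a z (2 * M) x‖ ^ 2 ≤
      2 * ‖orbitSum g a z M x‖ ^ 2 + 2 * ‖orbitSum g a z M (x + (M : ℤ) • a)‖ ^ 2 := by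
    intro x
    have h2 : ‖orbitSum g a z (2 * M) x‖ ≤
        ‖orbitSum g a z M x‖ + ‖orbitSum g a z M (x + (M : ℤ) • a)‖ := by
      rw [orbitSum_two_mul]
      refine (norm_add_le _ _).trans (le_of_eq ?_)
      rw [norm_mul, Circle.norm_coe_zpow, one_mul]
    have h3 := norm_nonneg (orbitSum g a z (2 * M) x)
    have h4 := pow_le_pow_left₀ h3 h2 2
    have h5 := add_sq_le (a := ‖orbitSum g a z M x‖) (b := ‖orbitSum g a z M (x + (M : ℤ) • a)‖)
    linarith
  have hM := hc M
  refine (integral_mono (Continuous.integrable_of_compactSpace ((hc _).norm.pow 2))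
    (Continuous.integrable_of_compactSpace (by fun_prop)) h1).trans (le_of_eq ?_)
  rw [integral_add (Continuous.integrable_of_compactSpace (by fun_prop))
    (Continuous.integrable_of_compactSpace (by fun_prop)), integral_const_mul, integral_const_mul,
    integral_add_right_eq_self (μ := μ) fun x => ‖orbitSum g a z M x‖ ^ 2]
  ring

/-- The autocorrelations of a nonzero continuous function along an orbit in a compact group do not
tend to `0` on average. -/
theorem exists_mul_sq_le_sum_correlation_sq [μ.IsOpenPosMeasure] {g : K → ℝ} (hg : Continuous g)
    (hg0 : g ≠ 0) (a : K) :
    ∃ c > (0 : ℝ), ∀ N : ℕ, c * (N : ℝ) ^ 2 ≤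
      ∑ k ∈ Finset.range N, ∑ l ∈ Finset.range N,
        (∫ x, g (x + ((k : ℤ) - l) • a) * g x ∂μ) ^ 2 := by
  classical
  set ρ : K → ℝ := fun y => ∫ x, g (x + y) * g x ∂μ with hρ
  have hρ0 : 0 < ρ 0 := by
    obtain ⟨x, hx⟩ := Function.ne_iff.1 hg0
    refine Continuous.integral_pos_of_hasCompactSupport_nonneg_nonzero (x := x) (by fun_prop)
      (HasCompactSupport.of_compactSpace _) (fun y => ?_) ?_
    · simpa using mul_self_nonneg (g y)
    · simpa using hx
  obtain ⟨B, hB⟩ : ∃ B, ∀ x, |g x| ≤ B := by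
    obtain ⟨B, hB⟩ := isCompact_univ.exists_bound_of_continuousOn hg.continuousOn
    exact ⟨B, fun x => hB x trivial⟩
  have hB0 : 0 ≤ B := (abs_nonneg _).trans (hB 0)
  set m := μ.real Set.univ
  have hm0 : 0 ≤ m := measureReal_nonneg
  set η := ρ 0 / 2 / (m * B + 1) with hη
  have hη0 : 0 < η := by positivity
  set V := {x : K | ∀ y, |g (y + x) - g y| ≤ η}
  have hV : V ∈ 𝓝 (0 : K) := hg.eventually_forall_abs_add_sub_le hη0
  have hVρ : ∀ y ∈ V, ρ 0 / 2 ≤ ρ y := by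
    intro y hy
    have h1 : |ρ y - ρ 0| ≤ η * B * m := by
      simp only [hρ]
      rw [← integral_sub (Continuous.integrable_of_compactSpace (by fun_prop))
        (Continuous.integrable_of_compactSpace (by fun_prop)), ← Real.norm_eq_abs]
      refine norm_integral_le_of_norm_le_const (.of_forall fun x => ?_)
      rw [add_zero, ← sub_mul, norm_mul]
      exact mul_le_mul (hy x) (hB x) (norm_nonneg _) hη0.le
    have h2 : η * B * m ≤ ρ 0 / 2 := by
      rw [hη, div_mul_eq_mul_div, div_mul_eq_mul_div, div_le_iff₀ (by positivity)]
      nlinarith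
    linarith [(abs_le.1 h1).1]
  obtain ⟨c, hc, hcN⟩ := exists_card_sq_le_sum_ite_sub_mem hV fun k => (k : ℤ) • a
  refine ⟨(ρ 0 / 2) ^ 2 * c, by positivity, fun N => ?_⟩
  rw [mul_assoc]
  refine (mul_le_mul_of_nonneg_left (hcN N) (by positivity)).trans ?_
  simp_rw [Finset.mul_sum]
  refine Finset.sum_le_sum fun k _ => Finset.sum_le_sum fun l _ => ?_
  split_ifs with h
  · rw [← sub_smul] at h
    rw [mul_one]
    exact pow_le_pow_left₀ (by positivity) (hVρ _ h) 2
  · rw [mul_zero]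
    positivity

/-- Points of a compact abelian group that are not killed by `d` are separated from `0` by circle-valued
homomorphisms of the cyclic group they generate, `n • a ↦ z ^ n` with `z ^ d ≠ 1`, continuous for the
topology of the compact group. -/
theorem exists_pow_ne_one_and_eventually {K : Type*} [AddCommGroup K] [TopologicalSpace K]
    [IsTopologicalAddGroup K] [CompactSpace K] [T2Space K] {a : K} {d : ℕ} (hd : d • a ≠ 0) :
    ∃ z : Circle, z ^ d ≠ 1 ∧
      ∀ ε > 0, ∀ᶠ x in 𝓝 (0 : K), ∀ n : ℤ, n • a = x → ‖(z : ℂ) ^ n - 1‖ ≤ ε := by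
  borelize K
  set μ : Measure K := Measure.addHaar
  set m := μ.real Set.univ
  have hm0 : 0 ≤ m := measureReal_nonneg
  have hbdd : ∀ f : K → ℝ, Continuous f → ∃ B, ∀ x, |f x| ≤ B := fun f hf => by
    obtain ⟨B, hB⟩ := isCompact_univ.exists_bound_of_continuousOn hf.continuousOn
    exact ⟨B, fun x => hB x trivial⟩
  obtain ⟨h, h0, h1, -⟩ := exists_continuous_zero_one_of_isClosed (X := K)
    (isClosed_singleton (x := 0)) (isClosed_singleton (x := d • a)) (by simpa using hd.symm)
  set g : K → ℝ := fun x => h (x + d • a) - h x with hg_def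
  have hg : Continuous g := by fun_prop
  have hg0 : g ≠ 0 := fun h2 => by
    have h3 := congrFun h2 0
    have h4 : h 0 = 0 := h0 rfl
    have h5 : h (d • a) = 1 := h1 rfl
    simp [hg_def, h4, h5] at h3
  obtain ⟨H, hH⟩ := hbdd h h.continuous
  obtain ⟨B, hB⟩ := hbdd g hg
  obtain ⟨c, hc, hcN⟩ := exists_mul_sq_le_sum_correlation_sq (μ := μ) hg hg0 a
  obtain ⟨z, s, hs, hz⟩ := exists_fejerSum_ge (r := fun k => ∫ x, g (x + k • a) * g x ∂μ)
    (I := fun M z => ∫ x, ‖orbitSum g a z M x‖ ^ 2 ∂μ)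
    (fun M z => integral_norm_orbitSum_sq hg a M z) (fun M z => integral_nonneg fun x => by positivity)
    (fun M z => integral_norm_orbitSum_two_mul_sq_le hg a M z) hc hcN
  have htwo : Tendsto (fun j : ℕ => (((2 ^ j : ℕ) : ℝ))⁻¹) atTop (𝓝 0) := by
    push_cast
    exact (tendsto_pow_atTop_atTop_of_one_lt one_lt_two).inv_tendsto_atTop
  have hupper : ∀ C : ℝ, ∀ t : ℝ, ∀ M : ℕ, 0 ≤ t → (∀ x, t * ‖orbitSum g a z M x‖ ≤ C) →
      t ^ 2 * ∫ x, ‖orbitSum g a z M x‖ ^ 2 ∂μ ≤ C ^ 2 * m := by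
    intro C t M ht hC
    rw [← integral_const_mul]
    refine (le_abs_self _).trans ?_
    rw [← Real.norm_eq_abs]
    refine norm_integral_le_of_norm_le_const (.of_forall fun x => ?_)
    rw [Real.norm_of_nonneg (by positivity), ← mul_pow]
    exact pow_le_pow_left₀ (by positivity) (hC x) 2
  refine ⟨z, fun hzd => ?_, fun ε hε => ?_⟩
  · -- The orbit sums would be bounded, while their norms grow.
    have h2 : ∀ j : ℕ, s ≤ (2 * d * H) ^ 2 * m * (((2 ^ j : ℕ) : ℝ))⁻¹ ^ 2 := by
      intro j
      have h3 := hupper (2 * d * H) 1 (2 ^ j) zero_le_one fun x => by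
        rw [one_mul]
        exact norm_orbitSum_coboundary_le hH hzd _ x
      rw [inv_pow, ← div_eq_mul_inv, le_div_iff₀ (by positivity)]
      linarith [hz j]
    have h3 := ge_of_tendsto' (((htwo.pow 2).const_mul ((2 * d * H) ^ 2 * m))) h2
    simp at h3
    linarith
  · -- Near `0` the translations move `g` by at most `η`, and the error term `2 |n| B` disappears on
    -- division by the length `2 ^ j`.
    set η := ε * √(s / (m + 1)) with hη
    have hη0 : 0 < η := by positivity
    filter_upwards [hg.eventually_forall_abs_add_sub_le hη0] with x hx n hn
    subst hn
    set t := ‖(z : ℂ) ^ n - 1‖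
    have h2 : ∀ j : ℕ, t ^ 2 * s ≤ (η + 2 * |(n : ℝ)| * B * (((2 ^ j : ℕ) : ℝ))⁻¹) ^ 2 * m := by
      intro j
      have h3 := hupper _ t (2 ^ j) (norm_nonneg _)
        (norm_zpow_sub_one_mul_orbitSum_le hB hx z (2 ^ j))
      have h4 := mul_le_mul_of_nonneg_left (hz j) (sq_nonneg t)
      have h5 : (0 : ℝ) < ((2 ^ j : ℕ) : ℝ) := by positivity
      refine le_of_mul_le_mul_right ?_ (pow_pos h5 2)
      calc t ^ 2 * s * ((2 ^ j : ℕ) : ℝ) ^ 2 = t ^ 2 * (s * ((2 ^ j : ℕ) : ℝ) ^ 2) := by ring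
        _ ≤ _ := h4.trans h3
        _ = _ := by field_simp
    have h3 := ge_of_tendsto' ((((htwo.const_mul (2 * |(n : ℝ)| * B)).const_add η).pow 2).mul_const m) h2
    rw [mul_zero, add_zero, hη, mul_pow, Real.sq_sqrt (by positivity)] at h3
    have h4 : ε ^ 2 * (s / (m + 1)) * m ≤ ε ^ 2 * s := by
      rw [mul_assoc]
      refine mul_le_mul_of_nonneg_left ?_ (by positivity)
      rw [div_mul_eq_mul_div, div_le_iff₀ (by positivity)]
      nlinarith
    exact le_of_sq_le_sq (le_of_mul_le_mul_right (h3.trans h4) hs) hε.le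

end CompactGroup

/-! ### Totally bounded group topologies -/

section TotallyBounded

/-- A version of `exists_pow_ne_one_and_eventually` for dense subgroups of compact groups. -/
theorem exists_pow_ne_one_and_eventually_of_precompact {A : Type*} [AddCommGroup A]
    [TopologicalSpace A] [IsTopologicalAddGroup A] [T2Space A]
    (hA : ∀ U : Set A, IsOpen U → U.Nonempty → ∃ F : Set A, F.Finite ∧ U + F = Set.univ)
    {a : A} {d : ℕ} (hd : d • a ≠ 0) :
    ∃ z : Circle, z ^ d ≠ 1 ∧
      ∀ ε > 0, ∀ᶠ x in 𝓝 (0 : A), ∀ n : ℤ, n • a = x → ‖(z : ℂ) ^ n - 1‖ ≤ ε := by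
  let _ := IsTopologicalAddGroup.rightUniformSpace A
  have : IsUniformAddGroup A := isUniformAddGroup_of_addCommGroup
  have htb : TotallyBounded (Set.univ : Set A) := by
    rw [totallyBounded_iff_subset_finite_iUnion_nhds_zero]
    intro U hU
    obtain ⟨F, hF, hUF⟩ := hA (interior U) isOpen_interior ⟨0, mem_interior_iff_mem_nhds.2 hU⟩
    refine ⟨F, hF, fun x _ => ?_⟩
    obtain ⟨u, hu, f, hf, rfl⟩ := Set.mem_add.1 (hUF ▸ Set.mem_univ x)
    refine Set.mem_biUnion hf ?_
    exact Set.mem_vadd_set.2 ⟨u, interior_subset hu, by simp [add_comm]⟩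
  have : CompactSpace (UniformSpace.Completion A) := by
    refine ⟨isCompact_iff_totallyBounded_isComplete.2 ⟨?_, completeSpace_iff_isComplete_univ.1 inferInstance⟩⟩
    have := (htb.image (UniformSpace.Completion.uniformContinuous_coe A)).closure
    rwa [Set.image_univ, UniformSpace.Completion.denseRange_coe.closure_range] at this
  set ι := UniformSpace.Completion.toCompl (α := A) with hι
  have hinj : Function.Injective ι := UniformSpace.Completion.coe_injective A
  obtain ⟨z, hz, h⟩ := exists_pow_ne_one_and_eventually (a := ι a) (d := d) (by
    rw [← map_nsmul]
    exact (map_ne_zero_iff ι hinj).2 hd)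
  refine ⟨z, hz, fun ε hε => ?_⟩
  have hcont : Tendsto ι (𝓝 0) (𝓝 0) := by
    rw [← map_zero ι]
    exact (UniformSpace.Completion.continuous_coe A).tendsto 0
  filter_upwards [hcont.eventually (h ε hε)] with x hx n hn
  exact hx n (by rw [← map_zsmul, hn])

/-- If the limit group had finite order `d`, then all its points would satisfy `z ^ d = 1`. -/
theorem infinite_limitGroup_of_isTBSequence {n : ℕ → ℤ} (hn : IsTBSequence n) :
    (limitGroup n : Set Circle).Infinite := by
  obtain ⟨τ, hgrp, hT2, hpre, hlim⟩ := hn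
  intro hfin
  have : Finite (limitGroup n) := hfin
  obtain ⟨z, hz, h⟩ := @exists_pow_ne_one_and_eventually_of_precompact ℤ _ τ hgrp hT2 hpre 1
    (Nat.card (limitGroup n)) (by simpa using Nat.card_pos.ne')
  refine hz ?_
  have hmem : z ∈ limitGroup n := by
    change Tendsto (fun k => z ^ n k) atTop (𝓝 1)
    rw [Metric.tendsto_atTop']
    intro ε hε
    have h1 := hlim.eventually (h (ε / 2) (half_pos hε))
    obtain ⟨N, hN⟩ := eventually_atTop.1 h1
    refine ⟨N, fun k hk => ?_⟩
    have h2 := hN k hk.le (n k) (by simp)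
    rw [Circle.dist_eq, Circle.coe_zpow, Circle.coe_one]
    linarith
  have := pow_card_eq_one' (x := (⟨z, hmem⟩ : limitGroup n))
  exact congrArg Subtype.val this

end TotallyBounded

theorem mainTheorem3 :
    (∀ n : ℕ → ℤ, IsTBSequence n → IsRigiditySequence n) ∧
    (∃ n : ℕ → ℤ, (∀ k, 0 < n k) ∧ IsRigiditySequence n ∧ ¬ IsTBSequence n) := by
  refine ⟨fun n hn => isRigiditySequence_of_infinite_limitGroup
    (infinite_limitGroup_of_isTBSequence hn), ?_⟩
  obtain ⟨n, hpos, hrig, hbot⟩ := exists_isRigiditySequence_limitGroup_eq_bot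
  refine ⟨n, hpos, hrig, fun hn => infinite_limitGroup_of_isTBSequence hn ?_⟩
  simp [hbot]
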